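/- Let $I \xleftarrow{s} E \xrightarrow{p} B \xrightarrow{t} I$ be a diagram of (small) groupoids and functors such that $p$ has finite discrete fibres: for every $b\in B$ the homotopy fibre $E_b$ (objects: pairs $(e,\varphi : p(e)\to b)$) is equivalent to a finite set. **The homotopy slice $\mathrm{Grpd}_{/I}$.** Objects are groupoids $X$ with a functor $\pi_X : X\to I$; arrows $X\to Y$ are functors $F:X\to Y$ with a specified natural isomorphism $\pi_X \Rightarrow \pi_Y F$; $2$-cells are natural transformations compatible with these isomorphisms. The terminal object is $1 = (\mathrm{id}: I\to I)$. **The polynomial endofunctor $P$.** The objects of $P(X)$ are pairs $(b,f)$ with $b\in B$ and $f : E_b\to X$ an arrow over $I$ (where $E_b$ lies over $I$ by $s$); an arrow $(b,f)\to(b',f')$ is an arrow $\beta:b\to b'$ of $B$ together with a $2$-cell $f\Rightarrow f'\circ\beta_!$ over $I$, where $\beta_! : E_b\to E_{b'}$ is composition with $\beta$; and $P(X)$ lies over $I$ by $(b,f)\mapsto t(b)$. On arrows and $2$-cells, $P$ is given by composition. **$(1+P)$-algebras.** A $(1+P)$-algebra is an object $X$ of $\mathrm{Grpd}_{/I}$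 with an arrow $1+P(X)\to X$. A morphism of algebras is an arrow of $\mathrm{Grpd}_{/I}$ together with a specified invertible $2$-cell filling the square of structure maps; a $2$-cell of algebras is a $2$-cell of $\mathrm{Grpd}_{/I}$ compatible with these. An algebra is *homotopy initial* if its groupoid of morphisms to any $(1+P)$-algebra is contractible (equivalent to a singleton). **$P$-trees.** A tree is a diagram of finite sets $A \xleftarrow{s} M \xrightarrow{p} N \xrightarrow{t} A$ such that $t$ is injective, $s$ is injective with complement of its image a singleton (the root), and such that the function $\sigma:A\to A$ with $\sigma(\mathrm{root})=\mathrm{root}$ and $\sigma(s(m))=t(p(m))$ carries every edge to the root after finitely many iterations. A $P$-tree is a tree with functors $\alpha : A\to I$, $\mu : M\to E$, $\nu : N\to B$ and specified isomorphisms filling the three squares to $I\leftarrow E\to B\to I$, the middle square being a homotopy pullback. An isomorphism of $P$-trees is an isomorphism of trees together with isomorphisms of the decorations $\alpha,\mu,\nu$ compatible with the specified isomorphisms. Let $W$ be the groupoid of $P$-trees and their isomorphisms, lying over $I$ by the decoration of the root edge. **Theorem.** Equip $W$ with the $(1+P)$-algebra structure $1+P(W)\to W$ that sends $i\in I$ to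 the trivial $P$-tree (a single edge decorated by $i$), and sends $(b, f:E_b\to W)$ to the $P$-tree obtained by grafting the trees $f(e)$, $e\in E_b$ (one for each isomorphism class of $E_b$), onto the leaves of the $P$-corolla $b$, whose root is decorated by $t(b)$. Then $W$ is a homotopy initial $(1+P)$-algebra, and its structure map $1+P(W)\to W$ is an equivalence in $\mathrm{Grpd}_{/I}$. -/

import Mathlib

open CategoryTheory

attribute [-instance] CategoryTheory.catToReflQuiver

universe y x v u y₁ x₁ y₂ x₂ y₃ x₃ y₄ x₄

/-- Objects of the homotopy slice over a groupoid `I`: groupoids equipped with a functor to `I`. -/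
structure GrpdOver (I : Type u) [Groupoid.{v} I] : Type (max u v (x + 1) (y + 1)) where
  C : Type x
  [cat : Category.{y} C]
  [grpd : IsGroupoid C]
  π : C ⥤ I

namespace GrpdOver

attribute [instance] GrpdOver.cat GrpdOver.grpd

variable {I : Type u} [Groupoid.{v} I]

/-- Arrows of the homotopy slice: triangles that commute up to a specified `2`-cell
(invertible, because `I` is a groupoid). -/
structure Hom (X : GrpdOver.{y₁, x₁} I) (Y : GrpdOver.{y₂, x₂} I) where
  F : X.C ⥤ Y.C
  tri : X.π ⟶ F ⋙ Y.π

/-- `2`-cells of the homotopy slice: natural transformations compatible with the triangles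
(invertible, because the target is a groupoid). -/
@[ext]
structure Cell {X : GrpdOver.{y₁, x₁} I} {Y : GrpdOver.{y₂, x₂} I} (f g : Hom X Y) where
  τ : f.F ⟶ g.F
  compat : f.tri ≫ Functor.whiskerRight τ Y.π = g.tri

section
variable {X : GrpdOver.{y₁, x₁} I} {Y : GrpdOver.{y₂, x₂} I} {Z : GrpdOver.{y₃, x₃} I}

/-- The mapping groupoid `Map_{/I}(X, Y)`. -/
instance : Category (Hom X Y) where
  Hom f g := Cell f g
  id f := ⟨𝟙 f.F, by ext; simp⟩
  comp a b := ⟨a.τ ≫ b.τ, by rw [Functor.whiskerRight_comp, ← Category.assoc, a.compat, b.compat]⟩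
  id_comp a := Cell.ext (Category.id_comp a.τ)
  comp_id a := Cell.ext (Category.comp_id a.τ)
  assoc a b c := Cell.ext (Category.assoc a.τ b.τ c.τ)

@[ext]
theorem cell_ext {f g : Hom X Y} {a b : f ⟶ g} (h : a.τ = b.τ) : a = b := Cell.ext h

@[simp]
theorem id_τ (f : Hom X Y) : Cell.τ (𝟙 f) = 𝟙 f.F := rfl

@[simp]
theorem comp_τ {f g h : Hom X Y} (a : f ⟶ g) (b : g ⟶ h) : Cell.τ (a ≫ b) = a.τ ≫ b.τ := rfl

/-- Identity arrow. -/
def idHom (X : GrpdOver.{y₁, x₁} I) : Hom X X := ⟨𝟭 X.C, 𝟙 X.π⟩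

/-- Composition of arrows (pasting of triangles). -/
def Hom.comp (f : Hom X Y) (g : Hom Y Z) : Hom X Z :=
  ⟨f.F ⋙ g.F, f.tri ≫ Functor.whiskerLeft f.F g.tri⟩

/-- Whiskering of a `2`-cell with an arrow on the right. -/
def whiskerR {f f' : Hom X Y} (a : f ⟶ f') (g : Hom Y Z) : f.comp g ⟶ f'.comp g where
  τ := Functor.whiskerRight a.τ g.F
  compat := by
    ext c
    have h := congrArg (fun k => NatTrans.app k c) a.compat
    simp only [NatTrans.comp_app, Functor.whiskerRight_app] at h
    simp [Hom.comp, ← h]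

/-- Whiskering of a `2`-cell with an arrow on the left. -/
def whiskerL (f : Hom X Y) {g g' : Hom Y Z} (b : g ⟶ g') : f.comp g ⟶ f.comp g' where
  τ := Functor.whiskerLeft f.F b.τ
  compat := by
    ext c
    have h := congrArg (fun k => NatTrans.app k (f.F.obj c)) b.compat
    simp only [NatTrans.comp_app, Functor.whiskerRight_app] at h
    simp [Hom.comp, ← h]

theorem whiskerR_id (f : Hom X Y) (g : Hom Y Z) : whiskerR (𝟙 f) g = 𝟙 (f.comp g) := by
  ext c
  exact g.F.map_id _

theorem whiskerR_comp {f f' f'' : Hom X Y} (a : f ⟶ f') (a' : f' ⟶ f'') (g : Hom Y Z) :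
    whiskerR (a ≫ a') g = whiskerR a g ≫ whiskerR a' g := by
  ext c
  exact g.F.map_comp _ _

theorem whiskerL_id (f : Hom X Y) (g : Hom Y Z) : whiskerL f (𝟙 g) = 𝟙 (f.comp g) := rfl

theorem whiskerL_comp (f : Hom X Y) {g g' g'' : Hom Y Z} (b : g ⟶ g') (b' : g' ⟶ g'') :
    whiskerL f (b ≫ b') = whiskerL f b ≫ whiskerL f b' := rfl

/-- An arrow of the homotopy slice is an equivalence if it has a pseudo-inverse in the slice. -/
def Hom.IsEquiv (f : Hom X Y) : Prop :=
  ∃ g : Hom Y X, Nonempty (f.comp g ≅ idHom X) ∧ Nonempty (g.comp f ≅ idHom Y)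

end

/-- The terminal object `id : I → I` of the homotopy slice. -/
@[reducible]
def one (I : Type u) [Groupoid.{v} I] : GrpdOver.{v, u} I where
  C := I
  π := 𝟭 I

/-- The sum of two objects of the homotopy slice. -/
@[reducible]
def sum (X : GrpdOver.{y₁, x₁} I) (Y : GrpdOver.{y₂, x₂} I) :
    GrpdOver.{max y₁ y₂, max x₁ x₂} I where
  C := X.C ⊕ Y.C
  grpd := ⟨fun {a b} f => match a, b, f with
    | .inl _, .inl _, f => inferInstanceAs (IsIso ((Sum.inl_ X.C Y.C).map f.down))
    | .inr _, .inr _, f => inferInstanceAs (IsIso ((Sum.inr_ X.C Y.C).map f.down))⟩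
  π := Functor.sum' X.π Y.π

section
variable {X : GrpdOver.{y₁, x₁} I} {X' : GrpdOver.{y₂, x₂} I}
  {Y : GrpdOver.{y₃, x₃} I} {Y' : GrpdOver.{y₄, x₄} I}

/-- Copairing of two arrows. -/
def Hom.copair (f : Hom X Y) (g : Hom X' Y) : Hom (sum X X') Y where
  F := Functor.sum' f.F g.F
  tri :=
    { app := fun c => match c with
        | .inl c => f.tri.app c
        | .inr c => g.tri.app c
      naturality := fun a b k => match a, b, k with
        | .inl _, .inl _, k => f.tri.naturality k.down
        | .inr _, .inr _, k => g.tri.naturality k.down }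

/-- The sum of two arrows. -/
def Hom.sumMap (f : Hom X Y) (g : Hom X' Y') : Hom (sum X X') (sum Y Y') where
  F := Functor.sum f.F g.F
  tri :=
    { app := fun c => match c with
        | .inl c => f.tri.app c
        | .inr c => g.tri.app c
      naturality := fun a b k => match a, b, k with
        | .inl _, .inl _, k => f.tri.naturality k.down
        | .inr _, .inr _, k => g.tri.naturality k.down }

/-- The sum of two `2`-cells. -/
def cellSum {f f' : Hom X Y} {g g' : Hom X' Y'} (a : f ⟶ f') (b : g ⟶ g') :
    f.sumMap g ⟶ f'.sumMap g' where
  τ := NatTrans.sum a.τ b.τ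
  compat := by
    ext c
    rcases c with c | c
    · exact congrArg (fun k => NatTrans.app k c) a.compat
    · exact congrArg (fun k => NatTrans.app k c) b.compat

end
end GrpdOver

/-- A polynomial `I ← E → B → I` of groupoids. -/
structure GrpdPoly (I : Type u) [Groupoid.{v} I] where
  E : Type u
  B : Type u
  [grpdE : Groupoid.{v} E]
  [grpdB : Groupoid.{v} B]
  s : E ⥤ I
  p : E ⥤ B
  t : B ⥤ I

namespace GrpdPoly

attribute [instance] GrpdPoly.grpdE GrpdPoly.grpdB

variable {I : Type u} [Groupoid.{v} I] (P : GrpdPoly I)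

/-- Objects of the homotopy fibre `E_b` of `p`: pairs `(e, φ)` with `φ : p e ⟶ b`. -/
structure Fib (b : P.B) where
  e : P.E
  φ : P.p.obj e ⟶ b

/-- Arrows of the homotopy fibre. -/
@[ext]
structure FibHom {b : P.B} (k l : P.Fib b) where
  g : k.e ⟶ l.e
  w : P.p.map g ≫ l.φ = k.φ

/-- The homotopy fibre `E_b` as a category; it is a groupoid. -/
instance (b : P.B) : Category (P.Fib b) where
  Hom k l := P.FibHom k l
  id k := ⟨𝟙 k.e, by simp⟩
  comp f f' := ⟨f.g ≫ f'.g, by rw [P.p.map_comp, Category.assoc, f'.w, f.w]⟩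
  id_comp f := FibHom.ext (Category.id_comp f.g)
  comp_id f := FibHom.ext (Category.comp_id f.g)
  assoc f f' f'' := FibHom.ext (Category.assoc f.g f'.g f''.g)

variable {P}

@[ext]
theorem fib_ext {b : P.B} {k l : P.Fib b} {f f' : k ⟶ l} (h : f.g = f'.g) : f = f' :=
  FibHom.ext h

@[simp]
theorem fib_id_g {b : P.B} (k : P.Fib b) : FibHom.g (𝟙 k) = 𝟙 k.e := rfl

@[simp]
theorem fib_comp_g {b : P.B} {k l m : P.Fib b} (f : k ⟶ l) (f' : l ⟶ m) :
    FibHom.g (f ≫ f') = f.g ≫ f'.g := rfl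

instance (b : P.B) : IsGroupoid (P.Fib b) where
  all_isIso {k l} f :=
    ⟨⟨⟨inv f.g, by rw [← f.w]; simp⟩, by ext; simp, by ext; simp⟩⟩

variable (P)

/-- The functor `β_! : E_b ⥤ E_{b'}`, `(e, φ) ↦ (e, β ∘ φ)`, induced by `β : b ⟶ b'`. -/
@[reducible]
def push {b b' : P.B} (β : b ⟶ b') : P.Fib b ⥤ P.Fib b' where
  obj k := ⟨k.e, k.φ ≫ β⟩
  map f := ⟨f.g, by rw [← Category.assoc, f.w]⟩

/-- The functor `p` has finite discrete fibres: each homotopy fibre is equivalent to a finite set,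
regarded as a groupoid with only identity arrows. -/
def Finitary : Prop :=
  ∀ b : P.B, ∃ n : ℕ, Nonempty (P.Fib b ≌ Discrete (Fin n))

/-- Objects of `P(X)`: pairs `(b, f)` with `b ∈ B` and `f : E_b ⥤ X` a map over `I`,
that is, a functor together with a (natural) `2`-cell `tri` filling the triangle over `I`. -/
structure Obj (X : GrpdOver.{y, x} I) where
  b : P.B
  f : P.Fib b ⥤ X.C
  tri : ∀ k : P.Fib b, P.s.obj k.e ⟶ X.π.obj (f.obj k)
  natural : ∀ {k l : P.Fib b} (g : k ⟶ l),
    P.s.map g.g ≫ tri l = tri k ≫ X.π.map (f.map g)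

variable {P} {X : GrpdOver.{y₁, x₁} I} {Y : GrpdOver.{y₂, x₂} I}

/-- Arrows `(b, f) ⟶ (b', f')` of `P(X)`: an arrow `β : b ⟶ b'` of `B` together with a `2`-cell
`f ⟶ f' ∘ β_!` over `I`. -/
structure ObjHom (w w' : P.Obj X) where
  β : w.b ⟶ w'.b
  γ : w.f ⟶ P.push β ⋙ w'.f
  compat : ∀ k : P.Fib w.b,
    w.tri k ≫ X.π.map (γ.app k) = w'.tri ((P.push β).obj k)

/-- The arrow of `E_b` between two objects with the same underlying object of `E`. -/
@[reducible]
def fibEq {b : P.B} {e : P.E} {φ φ' : P.p.obj e ⟶ b} (h : φ = φ') :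
    (⟨e, φ⟩ : P.Fib b) ⟶ ⟨e, φ'⟩ := ⟨𝟙 e, by simp [h]⟩

theorem objHom_ext {w w' : P.Obj X} {k l : ObjHom w w'} (h : k.β = l.β)
    (h' : ∀ c : P.Fib w.b, k.γ.app c ≫ w'.f.map (fibEq (by rw [h])) = l.γ.app c) : k = l := by
  obtain ⟨β, γ, c⟩ := k
  obtain ⟨β', γ', c'⟩ := l
  dsimp only at h
  subst h
  congr 1
  ext e
  rw [← h' e]
  exact (Category.comp_id _).symm.trans (congrArg _ (w'.f.map_id _).symm)

theorem tri_fibEq (w : P.Obj X) {e : P.E} {φ φ' : P.p.obj e ⟶ w.b} (h : φ = φ') :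
    w.tri ⟨e, φ⟩ ≫ X.π.map (w.f.map (fibEq h)) = w.tri ⟨e, φ'⟩ := by
  have := w.natural (fibEq h)
  rw [← this]
  simp

/-- The identity arrow of an object of `P(X)`. -/
def idHom (w : P.Obj X) : ObjHom w w where
  β := 𝟙 w.b
  γ :=
    { app := fun k => w.f.map (fibEq (by simp))
      naturality := fun k l g => by
        rw [Functor.comp_map, ← w.f.map_comp, ← w.f.map_comp]
        congr 1
        ext
        simp }
  compat k := tri_fibEq w _

/-- Composition of arrows of `P(X)`. -/
def compHom {w w' w'' : P.Obj X} (k : ObjHom w w') (l : ObjHom w' w'') : ObjHom w w'' where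
  β := k.β ≫ l.β
  γ :=
    { app := fun c => k.γ.app c ≫ l.γ.app ((P.push k.β).obj c) ≫
        w''.f.map (fibEq (by simp))
      naturality := fun c c' g => by
        have h₁ := k.γ.naturality g
        have h₂ := l.γ.naturality ((P.push k.β).map g)
        simp only [Functor.comp_map] at h₁ h₂ ⊢
        rw [reassoc_of% h₁, reassoc_of% h₂]
        simp only [Category.assoc, ← w''.f.map_comp]
        congr 3
        ext
        simp }
  compat c := by
    have h₁ := k.compat c
    have h₂ := l.compat ((P.push k.β).obj c)
    rw [X.π.map_comp, X.π.map_comp, reassoc_of% h₁, reassoc_of% h₂]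
    exact tri_fibEq w'' _

instance : Category (P.Obj X) where
  Hom w w' := ObjHom w w'
  id w := idHom w
  comp k l := compHom k l
  id_comp {w w'} k := by
    refine objHom_ext (Category.id_comp k.β) fun c => ?_
    have h := k.γ.naturality (fibEq (show c.φ = c.φ ≫ 𝟙 _ by simp))
    simp only [idHom, compHom, Category.assoc] at h ⊢
    rw [reassoc_of% h]
    simp only [← w'.f.map_comp]
    refine Eq.trans (congrArg _ (Eq.trans (congrArg w'.f.map ?_) (w'.f.map_id _))) (Category.comp_id _)
    ext
    simp
  comp_id {w w'} k := by
    refine objHom_ext (Category.comp_id k.β) fun c => ?_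
    simp only [idHom, compHom, Category.assoc, ← w'.f.map_comp]
    refine Eq.trans (congrArg _ (Eq.trans (congrArg w'.f.map ?_) (w'.f.map_id _))) (Category.comp_id _)
    ext
    simp
  assoc {w w' w'' w'''} k l m := by
    refine objHom_ext (Category.assoc k.β l.β m.β) fun c => ?_
    have h := m.γ.naturality (fibEq (b := w''.b) (show (c.φ ≫ k.β) ≫ l.β = c.φ ≫ k.β ≫ l.β by simp))
    simp only [Functor.comp_map] at h
    simp only [compHom, Category.assoc]
    rw [reassoc_of% h]
    simp only [← w'''.f.map_comp]
    congr 4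
    ext
    simp

@[simp]
theorem id_β (w : P.Obj X) : ObjHom.β (𝟙 w) = 𝟙 w.b := rfl

@[simp]
theorem id_γ (w : P.Obj X) (c : P.Fib w.b) :
    (ObjHom.γ (𝟙 w)).app c = w.f.map (fibEq (by simp)) := rfl

@[simp]
theorem comp_β {w w' w'' : P.Obj X} (k : w ⟶ w') (l : w' ⟶ w'') :
    ObjHom.β (k ≫ l) = k.β ≫ l.β := rfl

@[simp]
theorem comp_γ {w w' w'' : P.Obj X} (k : w ⟶ w') (l : w' ⟶ w'') (c : P.Fib w.b) :
    (ObjHom.γ (k ≫ l)).app c = k.γ.app c ≫ l.γ.app ((P.push k.β).obj c) ≫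
        w''.f.map (fibEq (by simp)) := rfl

@[simp]
theorem map_fibEq_self {C : Type*} [Category C] {b : P.B} (f : P.Fib b ⥤ C) {e : P.E}
    {φ : P.p.obj e ⟶ b} (h : φ = φ) : f.map (fibEq h) = 𝟙 (f.obj ⟨e, φ⟩) := f.map_id ⟨e, φ⟩

theorem hom_inv_aux {w w' : P.Obj X} (k : ObjHom w w') (c : P.Fib w.b)
    {ψ χ ρ : P.p.obj c.e ⟶ w.b} (h₁ : c.φ ≫ k.β = ψ ≫ k.β) (h₂ : ψ = χ) (h₃ : χ = ρ)
    (h₄ : c.φ = ρ) :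
    (k.γ.app c ≫ (w'.f.map (fibEq h₁) ≫ inv (k.γ.app ⟨c.e, ψ⟩)) ≫ w.f.map (fibEq h₂)) ≫
      w.f.map (fibEq h₃) = w.f.map (fibEq h₄) := by
  obtain ⟨e, φ⟩ := c
  subst h₂ h₃ h₄
  simp

theorem inv_hom_aux {w w' : P.Obj X} (k : ObjHom w w') {e : P.E} {φ χ ρ : P.p.obj e ⟶ w'.b}
    {ψ : P.p.obj e ⟶ w.b} (h₁ : φ = ψ ≫ k.β) (h₂ : ψ ≫ k.β = χ) (h₃ : χ = ρ)
    (h₄ : φ = ρ) :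
    ((w'.f.map (fibEq h₁) ≫ inv (k.γ.app ⟨e, ψ⟩)) ≫ k.γ.app ⟨e, ψ⟩ ≫ w'.f.map (fibEq h₂)) ≫
      w'.f.map (fibEq h₃) = w'.f.map (fibEq h₄) := by
  subst h₁ h₂ h₃
  simp

instance : IsGroupoid (P.Obj X) where
  all_isIso {w w'} k := by
    let l : w' ⟶ w :=
      { β := inv k.β
        γ :=
          { app := fun c => w'.f.map (fibEq (by simp)) ≫ inv (k.γ.app ((P.push (inv k.β)).obj c))
            naturality := fun c c' g => by
              have h := k.γ.naturality ((P.push (inv k.β)).map g)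
              simp only [Functor.comp_map] at h ⊢
              rw [← cancel_mono (k.γ.app ((P.push (inv k.β)).obj c'))]
              simp only [Category.assoc, h, IsIso.inv_hom_id, IsIso.inv_hom_id_assoc,
                Category.comp_id]
              simp only [← w'.f.map_comp]
              congr 1
              ext
              simp }
        compat := fun c => by
          have h := k.compat ((P.push (inv k.β)).obj c)
          rw [← cancel_mono (X.π.map (k.γ.app ((P.push (inv k.β)).obj c))), h]
          simp only [Category.assoc, ← X.π.map_comp, IsIso.inv_hom_id, Category.comp_id]
          exact tri_fibEq w' _ }
    refine ⟨⟨l, ?_, ?_⟩⟩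
    · exact objHom_ext (IsIso.hom_inv_id k.β) fun c => hom_inv_aux k c _ _ _ _
    · exact objHom_ext (IsIso.inv_hom_id k.β) fun c => inv_hom_aux k _ _ _ _

variable (P) in
/-- The polynomial endofunctor of the homotopy slice on objects: `P(X)`, the groupoid of
`X`-decorated `P`-corollas, lying over `I` via `(b, f) ↦ t b`. -/
@[reducible]
def obj (X : GrpdOver.{y, x} I) : GrpdOver.{max u v y, max u v x y} I where
  C := P.Obj X
  π :=
    { obj := fun w => P.t.obj w.b
      map := fun k => P.t.map k.β }

open GrpdOver in
/-- The value of `P` on an arrow, on objects: `(b, f) ↦ (b, a ∘ f)`. -/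
@[reducible]
def mapObj (a : Hom X Y) (w : P.Obj X) : P.Obj Y where
  b := w.b
  f := w.f ⋙ a.F
  tri := fun k => w.tri k ≫ a.tri.app (w.f.obj k)
  natural := fun g => by
    have h := a.tri.naturality (w.f.map g)
    simp only [Functor.comp_map] at h ⊢
    rw [reassoc_of% w.natural g, h, Category.assoc]

open GrpdOver in
/-- The value of `P` on an arrow, on arrows. -/
@[reducible]
def mapHom (a : Hom X Y) {w w' : P.Obj X} (k : ObjHom w w') : ObjHom (mapObj a w) (mapObj a w') where
  β := k.β
  γ := Functor.whiskerRight k.γ a.F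
  compat := fun c => by
    have h := a.tri.naturality (k.γ.app c)
    simp only [Functor.comp_map] at h
    simp only [Functor.whiskerRight_app, Category.assoc, ← h]
    rw [reassoc_of% k.compat c]
    rfl

open GrpdOver in
variable (P) in
/-- The polynomial endofunctor on arrows: `(b, f) ↦ (b, a ∘ f)`. -/
def map (a : Hom X Y) : Hom (P.obj X) (P.obj Y) where
  F :=
    { obj := fun w => mapObj a w
      map := fun k => mapHom a k
      map_id := fun w => rfl
      map_comp := fun {w w' w''} k l => by
        change ObjHom.mk _ _ _ = ObjHom.mk _ _ _
        congr 1
        ext c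
        exact (a.F.map_comp _ _).trans (congrArg _ (a.F.map_comp _ _)) }
  tri := { app := fun w => 𝟙 _
           naturality := fun w w' k => by exact (Category.comp_id _).trans (Category.id_comp _).symm }

open GrpdOver in
/-- The value of `P` on a `2`-cell, at an object `(b, f)`. -/
@[reducible]
def map₂App {a a' : Hom X Y} (θ : a ⟶ a') (w : P.Obj X) : ObjHom (mapObj a w) (mapObj a' w) where
  β := 𝟙 w.b
  γ :=
    { app := fun c => θ.τ.app (w.f.obj c) ≫ a'.F.map (w.f.map (fibEq (by simp)))
      naturality := fun c c' g => by
        simp only [Functor.comp_map]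
        rw [θ.τ.naturality_assoc, Category.assoc]
        simp only [← a'.F.map_comp, ← w.f.map_comp]
        congr 3
        ext
        simp }
  compat := fun c => by
    have h := congrArg (fun k => NatTrans.app k (w.f.obj c)) θ.compat
    simp only [NatTrans.comp_app, Functor.whiskerRight_app] at h
    have h' := a'.tri.naturality (w.f.map (fibEq (show c.φ = c.φ ≫ 𝟙 _ by simp)))
    simp only [Functor.comp_map] at h'
    rw [Category.assoc, Y.π.map_comp, reassoc_of% h, ← h', ← Category.assoc]
    exact congrArg (· ≫ _) (tri_fibEq w _)

open GrpdOver in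
theorem map₂_aux {a a' : Hom X Y} (θ : a ⟶ a') {w w' : P.Obj X} (k : ObjHom w w')
    (c : P.Fib w.b) {φ₁ φ₂ φ₃ : P.p.obj c.e ⟶ w'.b} {ψ : P.p.obj c.e ⟶ w.b}
    (h₁ : c.φ ≫ k.β = φ₁) (h₂ : φ₁ = φ₂) (h₂' : φ₂ = φ₃) (h₃ : c.φ = ψ) (h₄ : ψ ≫ k.β = φ₃) :
    (a.F.map (k.γ.app c) ≫ (θ.τ.app (w'.f.obj ⟨c.e, c.φ ≫ k.β⟩) ≫
      a'.F.map (w'.f.map (fibEq h₁))) ≫ a'.F.map (w'.f.map (fibEq h₂))) ≫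
        a'.F.map (w'.f.map (fibEq h₂')) =
    (θ.τ.app (w.f.obj c) ≫ a'.F.map (w.f.map (fibEq h₃))) ≫
      a'.F.map (k.γ.app ⟨c.e, ψ⟩) ≫ a'.F.map (w'.f.map (fibEq h₄)) := by
  obtain ⟨e, φ⟩ := c
  subst h₁ h₂ h₂' h₃
  simp

open GrpdOver in
variable (P) in
/-- The polynomial endofunctor on `2`-cells. -/
def map₂ {a a' : Hom X Y} (θ : a ⟶ a') : P.map a ⟶ P.map a' where
  τ :=
    { app := fun w => map₂App θ w
      naturality := fun w w' k => by
        refine objHom_ext ((Category.comp_id _).trans (Category.id_comp _).symm) fun c => ?_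
        exact map₂_aux θ k c _ _ _ _ _ }
  compat := by
    ext w
    exact (Category.id_comp _).trans (P.t.map_id _)

open GrpdOver in
theorem map₂_id (a : Hom X Y) : P.map₂ (𝟙 a) = 𝟙 (P.map a) := by
  ext w
  refine objHom_ext rfl fun c => ?_
  refine (congrArg _ (map_fibEq_self _ _)).trans ((Category.comp_id _).trans ?_)
  exact Category.id_comp _

open GrpdOver in
theorem map₂_comp_aux {a a' a'' : Hom X Y} (θ : a ⟶ a') (θ' : a' ⟶ a'') (w : P.Obj X)
    (c : P.Fib w.b) {ψ χ ρ σ : P.p.obj c.e ⟶ w.b} (h : c.φ = ψ) (h₁ : ψ = χ) (h₂ : χ = ρ)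
    (h₃ : c.φ = σ) (h₄ : σ = ρ) :
    (θ.τ.app (w.f.obj c) ≫ θ'.τ.app (w.f.obj c)) ≫ a''.F.map (w.f.map (fibEq h₃)) ≫
      a''.F.map (w.f.map (fibEq h₄)) =
    (θ.τ.app (w.f.obj c) ≫ a'.F.map (w.f.map (fibEq h))) ≫ (θ'.τ.app (w.f.obj ⟨c.e, ψ⟩) ≫
      a''.F.map (w.f.map (fibEq h₁))) ≫ a''.F.map (w.f.map (fibEq h₂)) := by
  obtain ⟨e, φ⟩ := c
  subst h h₁ h₂ h₃
  simp

open GrpdOver in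
theorem map₂_comp {a a' a'' : Hom X Y} (θ : a ⟶ a') (θ' : a' ⟶ a'') :
    P.map₂ (θ ≫ θ') = P.map₂ θ ≫ P.map₂ θ' := by
  ext w
  refine objHom_ext (Category.comp_id _).symm fun c => ?_
  refine Eq.trans ?_ (map₂_comp_aux θ θ' w c _ _ _ (Category.comp_id _).symm
    ((congrArg _ (Category.comp_id (𝟙 w.b))).symm))
  exact Category.assoc _ _ _

end GrpdPoly

/-- A (finite rooted) tree: a diagram of finite sets `A ← M → N → A` (edges, nodes with a marked
input edge, nodes, edges) satisfying the tree axioms. -/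
structure FinTree where
  A : Type
  M : Type
  N : Type
  finA : Finite A
  finM : Finite M
  finN : Finite N
  s : M → A
  p : M → N
  t : N → A
  root : A
  t_inj : Function.Injective t
  s_inj : Function.Injective s
  compl_s : (Set.range s)ᶜ = {root}
  /-- The walk-to-the-root function `σ`, given by `root ↦ root` and `s m ↦ t (p m)`, sends every
  edge to the root after finitely many steps. -/
  walk : ∃ σ : A → A, σ root = root ∧ (∀ m, σ (s m) = t (p m)) ∧ ∀ a, ∃ k : ℕ, σ^[k] a = root

section

variable {I : Type u} [Groupoid.{v} I]

/-- A `P`-tree: a tree with decorations `α : A → I`, `μ : M → E`, `ν : N → B` making the three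
squares of the diagram commute up to specified isomorphisms, the middle square being a homotopy
pullback. The comma category of two functors of groupoids is their homotopy pullback. -/
structure PTree (P : GrpdPoly I) extends FinTree where
  α : A → I
  μ : M → P.E
  ν : N → P.B
  cs : ∀ m, P.s.obj (μ m) ⟶ α (s m)
  cp : ∀ m, P.p.obj (μ m) ⟶ ν (p m)
  ct : ∀ n, P.t.obj (ν n) ⟶ α (t n)
  cart : (Discrete.functor fun m =>
    (⟨μ m, ⟨p m⟩, cp m⟩ : Comma P.p (Discrete.functor ν))).IsEquivalence

namespace PTree

variable {P : GrpdPoly I}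

/-- An isomorphism of `P`-trees: an isomorphism of the underlying trees, together with
isomorphisms of the decorations, compatible with the specified isomorphisms in the three squares.
The `eqToHom`s only identify decorations of equal edges or nodes. -/
structure Hom (T T' : PTree P) where
  a : T.A ≃ T'.A
  m : T.M ≃ T'.M
  n : T.N ≃ T'.N
  hs : ∀ i, T'.s (m i) = a (T.s i)
  hp : ∀ i, T'.p (m i) = n (T.p i)
  ht : ∀ i, T'.t (n i) = a (T.t i)
  α : ∀ i, T.α i ⟶ T'.α (a i)
  μ : ∀ i, T.μ i ⟶ T'.μ (m i)
  ν : ∀ i, T.ν i ⟶ T'.ν (n i)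
  cs : ∀ i, T.cs i ≫ α (T.s i) =
    P.s.map (μ i) ≫ T'.cs (m i) ≫ eqToHom (congrArg T'.α (hs i))
  cp : ∀ i, T.cp i ≫ ν (T.p i) =
    P.p.map (μ i) ≫ T'.cp (m i) ≫ eqToHom (congrArg T'.ν (hp i))
  ct : ∀ i, T.ct i ≫ α (T.t i) =
    P.t.map (ν i) ≫ T'.ct (n i) ≫ eqToHom (congrArg T'.α (ht i))

theorem hom_ext {T T' : PTree P} {h h' : Hom T T'} (ha : ∀ i, h.a i = h'.a i)
    (hm : ∀ i, h.m i = h'.m i) (hn : ∀ i, h.n i = h'.n i)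
    (hα : ∀ i, h.α i ≫ eqToHom (congrArg T'.α (ha i)) = h'.α i)
    (hμ : ∀ i, h.μ i ≫ eqToHom (congrArg T'.μ (hm i)) = h'.μ i)
    (hν : ∀ i, h.ν i ≫ eqToHom (congrArg T'.ν (hn i)) = h'.ν i) : h = h' := by
  obtain ⟨a, m, n, hs, hp, ht, α, μ, ν, cs, cp, ct⟩ := h
  obtain ⟨a', m', n', hs', hp', ht', α', μ', ν', cs', cp', ct'⟩ := h'
  obtain rfl : a = a' := Equiv.ext ha
  obtain rfl : m = m' := Equiv.ext hm
  obtain rfl : n = n' := Equiv.ext hn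
  obtain rfl : α = α' := funext fun i => by simpa using hα i
  obtain rfl : μ = μ' := funext fun i => by simpa using hμ i
  obtain rfl : ν = ν' := funext fun i => by simpa using hν i
  rfl

/-- Moving a family of arrows past an identification of indices. -/
theorem family_eqToHom {S C : Type*} [Category C] {f g : S → C} (k : ∀ i, f i ⟶ g i) {i j : S}
    (h : i = j) :
    eqToHom (congrArg f h) ≫ k j = k i ≫ eqToHom (congrArg g h) := by
  subst h
  simp

theorem comp_aux {S S' S'' C : Type*} [Category C] {f : S → C} {f' : S' → C} {f'' : S'' → C}
    {a : S → S'} {a' : S' → S''} (k : ∀ i, f i ⟶ f' (a i)) (k' : ∀ i, f' i ⟶ f'' (a' i))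
    {x x' x'' : C} {s : S} {s' : S'} {s'' : S''} {c : x ⟶ f s} {c' : x' ⟶ f' s'}
    {c'' : x'' ⟶ f'' s''} {g : x ⟶ x'} {g' : x' ⟶ x''} (e : s' = a s) (e' : s'' = a' s')
    (h : c ≫ k s = g ≫ c' ≫ eqToHom (congrArg f' e))
    (h' : c' ≫ k' s' = g' ≫ c'' ≫ eqToHom (congrArg f'' e')) (e'' : s'' = a' (a s)) :
    c ≫ k s ≫ k' (a s) = (g ≫ g') ≫ c'' ≫ eqToHom (congrArg f'' e'') := by
  subst e e'
  simp only [eqToHom_refl, Category.comp_id, Category.assoc] at h h' ⊢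
  rw [reassoc_of% h, h']

/-- The identity isomorphism. -/
@[reducible]
def Hom.id (T : PTree P) : Hom T T where
  a := Equiv.refl _
  m := Equiv.refl _
  n := Equiv.refl _
  hs := fun _ => rfl
  hp := fun _ => rfl
  ht := fun _ => rfl
  α := fun _ => 𝟙 _
  μ := fun _ => 𝟙 _
  ν := fun _ => 𝟙 _
  cs := fun i => by simp
  cp := fun i => by simp
  ct := fun i => by simp

/-- Composition of isomorphisms of `P`-trees. -/
@[reducible]
def Hom.comp {T T' T'' : PTree P} (h : Hom T T') (h' : Hom T' T'') : Hom T T'' where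
  a := h.a.trans h'.a
  m := h.m.trans h'.m
  n := h.n.trans h'.n
  hs := fun i => (h'.hs _).trans (congrArg h'.a (h.hs i))
  hp := fun i => (h'.hp _).trans (congrArg h'.n (h.hp i))
  ht := fun i => (h'.ht _).trans (congrArg h'.a (h.ht i))
  α := fun i => h.α i ≫ h'.α (h.a i)
  μ := fun i => h.μ i ≫ h'.μ (h.m i)
  ν := fun i => h.ν i ≫ h'.ν (h.n i)
  cs := fun i => (comp_aux h.α h'.α (h.hs i) (h'.hs _) (h.cs i) (h'.cs (h.m i))
    ((h'.hs _).trans (congrArg h'.a (h.hs i)))).trans (congrArg (· ≫ _) (P.s.map_comp _ _).symm)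
  cp := fun i => (comp_aux h.ν h'.ν (h.hp i) (h'.hp _) (h.cp i) (h'.cp (h.m i))
    ((h'.hp _).trans (congrArg h'.n (h.hp i)))).trans (congrArg (· ≫ _) (P.p.map_comp _ _).symm)
  ct := fun i => (comp_aux h.α h'.α (h.ht i) (h'.ht _) (h.ct i) (h'.ct (h.n i))
    ((h'.ht _).trans (congrArg h'.a (h.ht i)))).trans (congrArg (· ≫ _) (P.t.map_comp _ _).symm)

/-- The groupoid of `P`-trees. -/
instance : Category (PTree P) where
  Hom T T' := Hom T T'
  id T := Hom.id T
  comp h h' := Hom.comp h h'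
  id_comp _ := hom_ext (fun _ => rfl) (fun _ => rfl) (fun _ => rfl)
    (fun _ => (Category.comp_id _).trans (Category.id_comp _))
    (fun _ => (Category.comp_id _).trans (Category.id_comp _))
    (fun _ => (Category.comp_id _).trans (Category.id_comp _))
  comp_id _ := hom_ext (fun _ => rfl) (fun _ => rfl) (fun _ => rfl)
    (fun _ => (Category.comp_id _).trans (Category.comp_id _))
    (fun _ => (Category.comp_id _).trans (Category.comp_id _))
    (fun _ => (Category.comp_id _).trans (Category.comp_id _))
  assoc _ _ _ := hom_ext (fun _ => rfl) (fun _ => rfl) (fun _ => rfl)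
    (fun _ => (Category.comp_id _).trans (Category.assoc _ _ _))
    (fun _ => (Category.comp_id _).trans (Category.assoc _ _ _))
    (fun _ => (Category.comp_id _).trans (Category.assoc _ _ _))

theorem symm_square {S S' R R' : Type*} {σ : R → S} {σ' : R' → S'} (a : S ≃ S') (m : R ≃ R')
    (hσ : ∀ i, σ' (m i) = a (σ i)) (i : R') : σ (m.symm i) = a.symm (σ' i) := by
  rw [Equiv.eq_symm_apply, ← hσ, Equiv.apply_symm_apply]

theorem inv_aux {S S' R R' C D : Type*} [Category C] [Category D] {f : S → C} {f' : S' → C}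
    {r : R → D} {r' : R' → D} {σ : R → S} {σ' : R' → S'} (F : D ⥤ C) (a : S ≃ S') (m : R ≃ R')
    (k : ∀ i, f i ⟶ f' (a i)) (l : ∀ i, r i ⟶ r' (m i)) [∀ i, IsIso (k i)] [∀ i, IsIso (l i)]
    (c : ∀ i, F.obj (r i) ⟶ f (σ i)) (c' : ∀ i, F.obj (r' i) ⟶ f' (σ' i))
    (hσ : ∀ i, σ' (m i) = a (σ i))
    (h : ∀ i, c i ≫ k (σ i) = F.map (l i) ≫ c' (m i) ≫ eqToHom (congrArg f' (hσ i)))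
    {i : R'} {j : R} (hj : i = m j) {s : S} (hs : σ' i = a s) (hs' : σ j = s) :
    c' i ≫ eqToHom (congrArg f' hs) ≫ inv (k s) =
      F.map (eqToHom (congrArg r' hj) ≫ inv (l j)) ≫ c j ≫ eqToHom (congrArg f hs') := by
  subst hj hs'
  rw [← cancel_mono (k (σ j))]
  simp [h]

theorem hom_inv_aux {S S' C : Type*} [Category C] {f : S → C} {f' : S' → C} (a : S ≃ S')
    (k : ∀ i, f i ⟶ f' (a i)) [∀ i, IsIso (k i)] (i : S) :
    (k i ≫ eqToHom (congrArg f' (a.apply_symm_apply (a i)).symm) ≫ inv (k (a.symm (a i)))) ≫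
      eqToHom (congrArg f (a.symm_apply_apply i)) = 𝟙 _ := by
  have h := family_eqToHom k (a.symm_apply_apply i).symm
  rw [← reassoc_of% h]
  simp

theorem inv_hom_aux {S S' C : Type*} [Category C] {f : S → C} {f' : S' → C} (a : S ≃ S')
    (k : ∀ i, f i ⟶ f' (a i)) [∀ i, IsIso (k i)] (i : S') :
    ((eqToHom (congrArg f' (a.apply_symm_apply i).symm) ≫ inv (k (a.symm i))) ≫ k (a.symm i)) ≫
      eqToHom (congrArg f' (a.apply_symm_apply i)) = 𝟙 _ := by
  simp

instance : IsGroupoid (PTree P) where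
  all_isIso {T T'} h := by
    let g : T' ⟶ T :=
      { a := h.a.symm
        m := h.m.symm
        n := h.n.symm
        hs := symm_square h.a h.m h.hs
        hp := symm_square h.n h.m h.hp
        ht := symm_square h.a h.n h.ht
        α := fun i => eqToHom (congrArg T'.α (h.a.apply_symm_apply i).symm) ≫ inv (h.α _)
        μ := fun i => eqToHom (congrArg T'.μ (h.m.apply_symm_apply i).symm) ≫ inv (h.μ _)
        ν := fun i => eqToHom (congrArg T'.ν (h.n.apply_symm_apply i).symm) ≫ inv (h.ν _)
        cs := fun i => inv_aux P.s h.a h.m h.α h.μ T.cs T'.cs h.hs h.cs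
          (h.m.apply_symm_apply i).symm (h.a.apply_symm_apply _).symm (symm_square h.a h.m h.hs i)
        cp := fun i => inv_aux P.p h.n h.m h.ν h.μ T.cp T'.cp h.hp h.cp
          (h.m.apply_symm_apply i).symm (h.n.apply_symm_apply _).symm (symm_square h.n h.m h.hp i)
        ct := fun i => inv_aux P.t h.a h.n h.α h.ν T.ct T'.ct h.ht h.ct
          (h.n.apply_symm_apply i).symm (h.a.apply_symm_apply _).symm (symm_square h.a h.n h.ht i) }
    refine ⟨⟨g, ?_, ?_⟩⟩
    · refine hom_ext (fun i => h.a.symm_apply_apply i) (fun i => h.m.symm_apply_apply i)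
        (fun i => h.n.symm_apply_apply i) (fun i => ?_) (fun i => ?_) (fun i => ?_)
      · exact hom_inv_aux h.a h.α i
      · exact hom_inv_aux h.m h.μ i
      · exact hom_inv_aux h.n h.ν i
    · refine hom_ext (fun i => h.a.apply_symm_apply i) (fun i => h.m.apply_symm_apply i)
        (fun i => h.n.apply_symm_apply i) (fun i => ?_) (fun i => ?_) (fun i => ?_)
      · exact inv_hom_aux h.a h.α i
      · exact inv_hom_aux h.m h.μ i
      · exact inv_hom_aux h.n h.ν i

/-- Isomorphisms of `P`-trees preserve the root. -/
theorem root_eq {T T' : PTree P} (h : Hom T T') : h.a T.root = T'.root := by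
  have h₁ : T.root ∈ (Set.range T.s)ᶜ := by rw [T.compl_s]; rfl
  have h₂ : h.a T.root ∈ (Set.range T'.s)ᶜ := by
    rintro ⟨i, hi⟩
    refine h₁ ⟨h.m.symm i, ?_⟩
    apply h.a.injective
    rw [← h.hs, Equiv.apply_symm_apply, hi]
  rw [T'.compl_s] at h₂
  exact h₂

/-- The effect of an isomorphism on the decoration of the root. -/
def Hom.onRoot {T T' : PTree P} (h : Hom T T') : T.α T.root ⟶ T'.α T'.root :=
  h.α T.root ≫ eqToHom (congrArg T'.α (root_eq h))

theorem onRoot_id (T : PTree P) : Hom.onRoot (𝟙 T) = 𝟙 (T.α T.root) := by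
  exact Category.comp_id _

theorem onRoot_comp {T T' T'' : PTree P} (h : T ⟶ T') (h' : T' ⟶ T'') :
    Hom.onRoot (h ≫ h') = Hom.onRoot h ≫ Hom.onRoot h' := by
  have h₁ := family_eqToHom h'.α (root_eq h)
  simp only [Hom.onRoot, Category.assoc]
  rw [reassoc_of% h₁]
  simp only [eqToHom_trans]
  exact Category.assoc _ _ _

end PTree

/-- The groupoid of `P`-trees as an object of the homotopy slice: a `P`-tree lies over the
decoration of its root. -/
@[reducible]
def GrpdPoly.trees (P : GrpdPoly I) : GrpdOver.{v, max 1 u v} I where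
  C := PTree P
  π :=
    { obj := fun T => T.α T.root
      map := fun h => PTree.Hom.onRoot h
      map_id := PTree.onRoot_id
      map_comp := PTree.onRoot_comp }

namespace FinTree

theorem s_ne_root (T : FinTree) (m : T.M) : T.s m ≠ T.root := fun h => by
  have : T.root ∈ (Set.range T.s)ᶜ := by rw [T.compl_s]; rfl
  exact this ⟨m, h⟩

theorem eq_s_of_ne_root (T : FinTree) {a : T.A} (h : a ≠ T.root) : ∃ m, T.s m = a := by
  by_contra h'
  have : a ∈ (Set.range T.s)ᶜ := h'
  rw [T.compl_s] at this
  exact h this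

/-- The trivial tree: a single edge and no nodes. -/
@[reducible]
def trivial : FinTree where
  A := Unit
  M := Empty
  N := Empty
  finA := inferInstance
  finM := inferInstance
  finN := inferInstance
  s := Empty.elim
  p := Empty.elim
  t := Empty.elim
  root := ()
  t_inj := fun x => x.elim
  s_inj := fun x => x.elim
  compl_s := by ext; simp
  walk := ⟨_root_.id, rfl, fun m => m.elim, fun _ => ⟨0, rfl⟩⟩

theorem graft_walk {J : Type} (T : J → FinTree) :
    ∃ σ : Option (Σ j, (T j).A) → Option (Σ j, (T j).A), σ none = none ∧
      (∀ j, σ (some ⟨j, (T j).root⟩) = none) ∧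
      (∀ j m, σ (some ⟨j, (T j).s m⟩) = some ⟨j, (T j).t ((T j).p m)⟩) ∧
      ∀ a, ∃ k : ℕ, σ^[k] a = none := by
  classical
  choose σ h₁ h₂ h₃ using fun j => (T j).walk
  let τ : Option (Σ j, (T j).A) → Option (Σ j, (T j).A) := fun a => match a with
    | none => none
    | some ⟨j, a⟩ => if a = (T j).root then none else some ⟨j, σ j a⟩
  have hτ : ∀ j a, a ≠ (T j).root → τ (some ⟨j, a⟩) = some ⟨j, σ j a⟩ := fun j a h => if_neg h
  have hτ' : ∀ j, τ (some ⟨j, (T j).root⟩) = none := fun j => if_pos rfl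
  refine ⟨τ, rfl, hτ', fun j m => ?_, ?_⟩
  · rw [hτ j _ ((T j).s_ne_root m), h₂]
  · rintro (_ | ⟨j, a⟩)
    · exact ⟨0, rfl⟩
    · obtain ⟨k, hk⟩ := h₃ j a
      induction k generalizing a with
      | zero =>
        obtain rfl : a = (T j).root := hk
        exact ⟨1, hτ' j⟩
      | succ k ih =>
        by_cases ha : a = (T j).root
        · subst ha
          exact ⟨1, hτ' j⟩
        · obtain ⟨k', hk'⟩ := ih (σ j a) hk
          exact ⟨k' + 1, by rw [Function.iterate_succ_apply, hτ j a ha, hk']⟩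

/-- The tree obtained by grafting a finite family of trees onto the leaves of the corolla whose
set of leaves is `J`: the new root edge and the new node are `none`, and the root edge of the
`j`-th tree becomes the `j`-th input edge of the new node. -/
@[reducible]
def graft {J : Type} [Finite J] (T : J → FinTree) : FinTree where
  A := Option (Σ j, (T j).A)
  M := J ⊕ Σ j, (T j).M
  N := Option (Σ j, (T j).N)
  finA := by
    have := fun j => (T j).finA
    infer_instance
  finM := by
    have := fun j => (T j).finM
    infer_instance
  finN := by
    have := fun j => (T j).finN
    infer_instance
  s := fun m => match m with
    | .inl j => some ⟨j, (T j).root⟩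
    | .inr ⟨j, m⟩ => some ⟨j, (T j).s m⟩
  p := fun m => match m with
    | .inl _ => none
    | .inr ⟨j, m⟩ => some ⟨j, (T j).p m⟩
  t := fun n => match n with
    | none => none
    | some ⟨j, n⟩ => some ⟨j, (T j).t n⟩
  root := none
  t_inj := by
    rintro (_ | ⟨j, n⟩) (_ | ⟨j', n'⟩) h
    · rfl
    · simp at h
    · simp at h
    · simp only [Option.some.injEq, Sigma.mk.injEq] at h ⊢
      obtain ⟨rfl, h⟩ := h
      simpa [(T j).t_inj.eq_iff] using h
  s_inj := by
    rintro (j | ⟨j, m⟩) (j' | ⟨j', m'⟩) h <;>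
      simp only [Option.some.injEq, Sigma.mk.injEq] at h <;> obtain ⟨rfl, h⟩ := h
    · rfl
    · exact ((T j).s_ne_root m' (eq_of_heq h).symm).elim
    · exact ((T j).s_ne_root m (eq_of_heq h)).elim
    · rw [(T j).s_inj (eq_of_heq h)]
  compl_s := by
    ext a
    simp only [Set.mem_compl_iff, Set.mem_range, Set.mem_singleton_iff]
    constructor
    · intro h
      rcases a with _ | ⟨j, a⟩
      · rfl
      · exfalso
        by_cases ha : a = (T j).root
        · exact h ⟨.inl j, by rw [ha]⟩
        · obtain ⟨m, rfl⟩ := (T j).eq_s_of_ne_root ha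
          exact h ⟨.inr ⟨j, m⟩, rfl⟩
    · rintro rfl ⟨j | ⟨j, m⟩, h⟩ <;> simp at h
  walk := by
    obtain ⟨σ, h₁, h₂, h₃, h₄⟩ := graft_walk T
    refine ⟨σ, h₁, ?_, h₄⟩
    rintro (j | ⟨j, m⟩)
    · exact h₂ j
    · exact h₃ j m

end FinTree

namespace GrpdPoly

variable {P : GrpdPoly I}

/-- An enumeration of the homotopy fibre `E_b`: a finite set of representatives of its isomorphism
classes. -/
structure Enum (P : GrpdPoly I) (b : P.B) where
  J : Type
  fin : Finite J
  x : J → P.Fib b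
  lab : P.Fib b → J
  lab_eq : ∀ {k l : P.Fib b}, (k ⟶ l) → lab k = lab l
  lab_x : ∀ j, lab (x j) = j
  iso : ∀ k, k ⟶ x (lab k)

attribute [instance] Enum.fin

/-- A chosen enumeration of a finite discrete homotopy fibre. -/
noncomputable def Finitary.enum (hP : P.Finitary) (b : P.B) : P.Enum b where
  J := Fin (hP b).choose
  fin := inferInstance
  x := fun j => (hP b).choose_spec.some.inverse.obj ⟨j⟩
  lab := fun k => ((hP b).choose_spec.some.functor.obj k).as
  lab_eq := fun f => Discrete.eq_of_hom ((hP b).choose_spec.some.functor.map f)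
  lab_x := fun j => Discrete.eq_of_hom ((hP b).choose_spec.some.counit.app ⟨j⟩)
  iso := fun k => (hP b).choose_spec.some.unit.app k

theorem Finitary.thin (hP : P.Finitary) {b : P.B} {k l : P.Fib b} (f g : k ⟶ l) : f = g :=
  (hP b).choose_spec.some.functor.map_injective (Subsingleton.elim _ _)

end GrpdPoly

namespace PTree

variable {P : GrpdPoly I}

/-- The homotopy pullback condition, unfolded. -/
theorem cart_of (hP : P.Finitary) {M N : Type} {p : M → N} {μ : M → P.E} {ν : N → P.B}
    (cp : ∀ m, P.p.obj (μ m) ⟶ ν (p m))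
    (inj : ∀ m m' (h : p m = p m') (g : μ m ⟶ μ m'),
      P.p.map g ≫ cp m' = cp m ≫ eqToHom (congrArg ν h) → m = m')
    (surj : ∀ n e (φ : P.p.obj e ⟶ ν n), ∃ m, ∃ h : p m = n, ∃ g : μ m ⟶ e,
      P.p.map g ≫ φ = cp m ≫ eqToHom (congrArg ν h)) :
    (Discrete.functor fun m =>
      (⟨μ m, ⟨p m⟩, cp m⟩ : Comma P.p (Discrete.functor ν))).IsEquivalence := by
  have key : ∀ {n n' : N} (r : (⟨n⟩ : Discrete N) ⟶ ⟨n'⟩), (Discrete.functor ν).map r =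
      eqToHom (congrArg ν (Discrete.eq_of_hom r)) := by
    rintro n n' ⟨⟨h⟩⟩
    obtain rfl : n = n' := h
    rfl
  refine
    { faithful := ⟨fun {_ _} _ _ _ => Subsingleton.elim _ _⟩
      full := ⟨?_⟩
      essSurj := ⟨?_⟩ }
  · rintro ⟨m⟩ ⟨m'⟩ f
    have hm : m = m' := by
      refine inj m m' (Discrete.eq_of_hom f.right) f.left ?_
      rw [← key f.right]
      exact f.w
    subst hm
    refine ⟨𝟙 _, ?_⟩
    have h₁ : f.left = 𝟙 (μ m) := by
      have w := f.w
      have : (Discrete.functor ν).map f.right = 𝟙 (ν (p m)) := (key f.right).trans rfl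
      have w' : P.p.map f.left ≫ cp m = cp m := w.trans ((congrArg _ this).trans (Category.comp_id _))
      exact congrArg GrpdPoly.FibHom.g (hP.thin (k := ⟨μ m, cp m⟩) (l := ⟨μ m, cp m⟩)
        ⟨f.left, w'⟩ (𝟙 _))
    ext
    · exact h₁.symm
    · exact Subsingleton.elim _ _
  · rintro ⟨e, ⟨n⟩, φ⟩
    obtain ⟨m, rfl, g, h⟩ := surj n e φ
    refine ⟨⟨m⟩, ⟨Comma.isoMk (asIso g) (Iso.refl _) ?_⟩⟩
    exact h.trans (congrArg _ ((Discrete.functor ν).map_id _).symm)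

theorem cart_inj (T : PTree P) (m m' : T.M) (h : T.p m = T.p m') (g : T.μ m ⟶ T.μ m')
    (w : P.p.map g ≫ T.cp m' = T.cp m ≫ eqToHom (congrArg T.ν h)) : m = m' := by
  have := T.cart
  let F := Discrete.functor fun m =>
    (⟨T.μ m, ⟨T.p m⟩, T.cp m⟩ : Comma P.p (Discrete.functor T.ν))
  have key : ∀ {n n' : T.N} (h : n = n'), eqToHom (congrArg T.ν h) =
      (Discrete.functor T.ν).map (Discrete.eqToHom (X := ⟨n⟩) (Y := ⟨n'⟩) h) := by
    rintro n n' rfl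
    rfl
  have f : F.obj ⟨m⟩ ⟶ F.obj ⟨m'⟩ := ⟨g, Discrete.eqToHom h, w.trans (congrArg _ (key h))⟩
  exact Discrete.eq_of_hom (F.preimage f)

theorem cart_surj (T : PTree P) (n : T.N) (e : P.E) (φ : P.p.obj e ⟶ T.ν n) :
    ∃ m, ∃ h : T.p m = n, ∃ g : T.μ m ⟶ e,
      P.p.map g ≫ φ = T.cp m ≫ eqToHom (congrArg T.ν h) := by
  have := T.cart
  let F := Discrete.functor fun m =>
    (⟨T.μ m, ⟨T.p m⟩, T.cp m⟩ : Comma P.p (Discrete.functor T.ν))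
  obtain ⟨⟨m⟩, ⟨i⟩⟩ := Functor.EssSurj.mem_essImage F (⟨e, ⟨n⟩, φ⟩ : Comma _ _)
  have h : T.p m = n := Discrete.eq_of_hom i.hom.right
  subst h
  refine ⟨m, rfl, i.hom.left, i.hom.w.trans (congrArg _ ?_)⟩
  exact (congrArg _ (Subsingleton.elim _ (𝟙 _))).trans ((Discrete.functor T.ν).map_id _)

/-- The trivial `P`-tree on `i ∈ I`: a single edge decorated by `i`. -/
@[reducible]
def trivial (P : GrpdPoly I) (i : I) : PTree P where
  toFinTree := FinTree.trivial
  α := fun _ => i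
  μ := fun m => m.elim
  ν := fun n => n.elim
  cs := fun m => m.elim
  cp := fun m => m.elim
  ct := fun m => m.elim
  cart :=
    { faithful := ⟨fun {x} => x.as.elim⟩
      full := ⟨fun {x} => x.as.elim⟩
      essSurj := ⟨fun y => y.right.as.elim⟩ }

/-- The arrow of `P`-trees between trivial trees given by an arrow of `I`. -/
@[reducible]
def trivialHom (P : GrpdPoly I) {i j : I} (g : i ⟶ j) : Hom (trivial P i) (trivial P j) where
  a := Equiv.refl _
  m := Equiv.refl _
  n := Equiv.refl _
  hs := fun m => m.elim
  hp := fun m => m.elim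
  ht := fun m => m.elim
  α := fun _ => g
  μ := fun m => m.elim
  ν := fun m => m.elim
  cs := fun m => m.elim
  cp := fun m => m.elim
  ct := fun m => m.elim

/-- The trivial trees, as an arrow `1 → W` of the homotopy slice. -/
def trivialArrow (P : GrpdPoly I) : GrpdOver.Hom (GrpdOver.one I) P.trees where
  F :=
    { obj := fun i => trivial P i
      map := fun g => trivialHom P g
      map_id := fun i => hom_ext (fun _ => rfl) (fun _ => rfl) (fun _ => rfl)
        (fun _ => Category.comp_id _) (fun m => m.elim) (fun m => m.elim)
      map_comp := fun g g' => hom_ext (fun _ => rfl) (fun _ => rfl) (fun _ => rfl)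
        (fun _ => Category.comp_id _) (fun m => m.elim) (fun m => m.elim) }
  tri :=
    { app := fun i => 𝟙 i
      naturality := fun i j g => by
        exact (Category.comp_id _).trans
          ((Category.id_comp _).trans (Category.comp_id _)).symm }

/-- Grafting a family of `P`-trees, indexed by (an enumeration of) the homotopy fibre `E_b`, onto
the `P`-corolla `b`: the roots of the trees are glued to the leaves of the corolla. The new root
is decorated by `t b`, the new node by `b`, its input edges correspond to `E_b`, and all other
decorations are those of the trees of the family. -/
@[reducible]
def graftFamily (hP : P.Finitary) {b : P.B} (ε : P.Enum b) (T : ε.J → PTree P)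
    (c : ∀ j, P.s.obj (ε.x j).e ⟶ (T j).α (T j).root) : PTree P where
  toFinTree := FinTree.graft fun j => (T j).toFinTree
  α := fun a => match a with
    | none => P.t.obj b
    | some ⟨j, a⟩ => (T j).α a
  μ := fun m => match m with
    | .inl j => (ε.x j).e
    | .inr ⟨j, m⟩ => (T j).μ m
  ν := fun n => match n with
    | none => b
    | some ⟨j, n⟩ => (T j).ν n
  cs := fun m => match m with
    | .inl j => c j
    | .inr ⟨j, m⟩ => (T j).cs m
  cp := fun m => match m with
    | .inl j => (ε.x j).φ
    | .inr ⟨j, m⟩ => (T j).cp m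
  ct := fun n => match n with
    | none => 𝟙 _
    | some ⟨j, n⟩ => (T j).ct n
  cart := by
    refine cart_of hP (M := ε.J ⊕ Σ j, (T j).M) (N := Option (Σ j, (T j).N))
      (p := (FinTree.graft fun j => (T j).toFinTree).p)
      (μ := fun m => match m with
        | .inl j => (ε.x j).e
        | .inr ⟨j, m⟩ => (T j).μ m)
      (ν := fun n => match n with
        | none => b
        | some ⟨j, n⟩ => (T j).ν n)
      (fun m => match m with
        | .inl j => (ε.x j).φ
        | .inr ⟨j, m⟩ => (T j).cp m) ?_ ?_
    · rintro (j | ⟨j, m⟩) (j' | ⟨j', m'⟩) h g w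
      · have w' : P.p.map g ≫ (ε.x j').φ = (ε.x j).φ := w.trans (Category.comp_id _)
        have := ε.lab_eq (k := ε.x j) (l := ε.x j') ⟨g, w'⟩
        rw [ε.lab_x, ε.lab_x] at this
        rw [this]
      · simp at h
      · simp at h
      · have hj : j = j' := by
          simp only [Option.some.injEq, Sigma.mk.injEq] at h
          exact h.1
        subst hj
        have h' : (T j).p m = (T j).p m' := by simpa using h
        rw [(T j).cart_inj m m' h' g w]
    · rintro (_ | ⟨j, n⟩) e φ
      · obtain ⟨j, ⟨f⟩⟩ : ∃ j, Nonempty ((⟨e, φ⟩ : P.Fib b) ⟶ ε.x j) := ⟨_, ⟨ε.iso _⟩⟩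
        refine ⟨.inl j, rfl, inv f.g, Eq.trans ?_ (Category.comp_id _).symm⟩
        rw [Functor.map_inv, IsIso.inv_comp_eq]
        exact f.w.symm
      · obtain ⟨m, h, g, w⟩ := (T j).cart_surj n e φ
        exact ⟨.inr ⟨j, m⟩, by simp [h], g, w⟩

/-- The effect of grafting on isomorphisms. -/
@[reducible]
def graftHom (hP : P.Finitary) {b b' : P.B} {ε : P.Enum b} {ε' : P.Enum b'} {T : ε.J → PTree P}
    {T' : ε'.J → PTree P} {c : ∀ j, P.s.obj (ε.x j).e ⟶ (T j).α (T j).root}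
    {c' : ∀ j, P.s.obj (ε'.x j).e ⟶ (T' j).α (T' j).root} (β : b ⟶ b') (σ : ε.J ≃ ε'.J)
    (ξ : ∀ j, (P.push β).obj (ε.x j) ⟶ ε'.x (σ j)) (h : ∀ j, T j ⟶ T' (σ j))
    (compat : ∀ j, c j ≫ Hom.onRoot (h j) = P.s.map (ξ j).g ≫ c' (σ j)) :
    Hom (graftFamily hP ε T c) (graftFamily hP ε' T' c') where
  a := Equiv.optionCongr (Equiv.sigmaCongr σ fun j => (h j).a)
  m := Equiv.sumCongr σ (Equiv.sigmaCongr σ fun j => (h j).m)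
  n := Equiv.optionCongr (Equiv.sigmaCongr σ fun j => (h j).n)
  hs := fun m => match m with
    | .inl j => congrArg (fun a => (some ⟨σ j, a⟩ : Option (Σ j, (T' j).A))) (root_eq (h j)).symm
    | .inr ⟨j, m⟩ => congrArg (fun a => (some ⟨σ j, a⟩ : Option (Σ j, (T' j).A))) ((h j).hs m)
  hp := fun m => match m with
    | .inl j => rfl
    | .inr ⟨j, m⟩ => congrArg (fun a => (some ⟨σ j, a⟩ : Option (Σ j, (T' j).N))) ((h j).hp m)
  ht := fun n => match n with
    | none => rfl
    | some ⟨j, n⟩ => congrArg (fun a => (some ⟨σ j, a⟩ : Option (Σ j, (T' j).A))) ((h j).ht n)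
  α := fun a => match a with
    | none => P.t.map β
    | some ⟨j, a⟩ => (h j).α a
  μ := fun m => match m with
    | .inl j => (ξ j).g
    | .inr ⟨j, m⟩ => (h j).μ m
  ν := fun n => match n with
    | none => β
    | some ⟨j, n⟩ => (h j).ν n
  cs := fun m => match m with
    | .inl j => by
      have := compat j
      rw [Hom.onRoot, ← Category.assoc, comp_eqToHom_iff, Category.assoc] at this
      exact this
    | .inr ⟨j, m⟩ => (h j).cs m
  cp := fun m => match m with
    | .inl j => (ξ j).w.symm.trans (congrArg _ (Category.comp_id _).symm)
    | .inr ⟨j, m⟩ => (h j).cp m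
  ct := fun n => match n with
    | none => (Category.id_comp _).trans
        ((congrArg _ (Category.comp_id _)).trans (Category.comp_id _)).symm
    | some ⟨j, n⟩ => (h j).ct n

theorem graftHom_congr (hP : P.Finitary) {b b' : P.B} {ε : P.Enum b} {ε' : P.Enum b'}
    {T : ε.J → PTree P} {T' : ε'.J → PTree P}
    {c : ∀ j, P.s.obj (ε.x j).e ⟶ (T j).α (T j).root}
    {c' : ∀ j, P.s.obj (ε'.x j).e ⟶ (T' j).α (T' j).root} {β γ : b ⟶ b'} {σ τ : ε.J ≃ ε'.J}
    {ξ : ∀ j, (P.push β).obj (ε.x j) ⟶ ε'.x (σ j)} {ζ : ∀ j, (P.push γ).obj (ε.x j) ⟶ ε'.x (τ j)}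
    {h : ∀ j, T j ⟶ T' (σ j)} {k : ∀ j, T j ⟶ T' (τ j)}
    {compat : ∀ j, c j ≫ Hom.onRoot (h j) = P.s.map (ξ j).g ≫ c' (σ j)}
    {compat' : ∀ j, c j ≫ Hom.onRoot (k j) = P.s.map (ζ j).g ≫ c' (τ j)}
    (hβ : β = γ) (hσ : ∀ j, σ j = τ j) (hh : ∀ j, h j ≫ eqToHom (congrArg T' (hσ j)) = k j) :
    graftHom hP β σ ξ h compat = graftHom hP γ τ ζ k compat' := by
  subst hβ
  obtain rfl : σ = τ := Equiv.ext hσ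
  obtain rfl : h = k := funext fun j => (Category.comp_id _).symm.trans (hh j)
  obtain rfl : ξ = ζ := funext fun j => hP.thin _ _
  rfl

theorem graftHom_id (hP : P.Finitary) {b : P.B} {ε : P.Enum b} {T : ε.J → PTree P}
    {c : ∀ j, P.s.obj (ε.x j).e ⟶ (T j).α (T j).root}
    (ξ : ∀ j, (P.push (𝟙 b)).obj (ε.x j) ⟶ ε.x j)
    (compat : ∀ j, c j ≫ Hom.onRoot (𝟙 (T j)) = P.s.map (ξ j).g ≫ c j) :
    graftHom hP (𝟙 b) (Equiv.refl _) ξ (fun j => 𝟙 (T j)) compat =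
      𝟙 (graftFamily hP ε T c) := by
  refine hom_ext ?_ ?_ ?_ ?_ ?_ ?_
  · rintro (_ | ⟨j, a⟩) <;> rfl
  · rintro (j | ⟨j, m⟩) <;> rfl
  · rintro (_ | ⟨j, a⟩) <;> rfl
  · rintro (_ | ⟨j, a⟩)
    · exact (Category.comp_id _).trans (P.t.map_id _)
    · exact Category.comp_id _
  · rintro (j | ⟨j, a⟩)
    · refine (Category.comp_id _).trans ?_
      exact congrArg GrpdPoly.FibHom.g (hP.thin (ξ j) (GrpdPoly.fibEq (Category.comp_id _)))
    · exact Category.comp_id _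
  · rintro (_ | ⟨j, a⟩)
    · exact Category.comp_id _
    · exact Category.comp_id _

theorem graftHom_comp (hP : P.Finitary) {b b' b'' : P.B} {ε : P.Enum b} {ε' : P.Enum b'}
    {ε'' : P.Enum b''} {T : ε.J → PTree P} {T' : ε'.J → PTree P} {T'' : ε''.J → PTree P}
    {c : ∀ j, P.s.obj (ε.x j).e ⟶ (T j).α (T j).root}
    {c' : ∀ j, P.s.obj (ε'.x j).e ⟶ (T' j).α (T' j).root}
    {c'' : ∀ j, P.s.obj (ε''.x j).e ⟶ (T'' j).α (T'' j).root}
    (β : b ⟶ b') (β' : b' ⟶ b'') (σ : ε.J ≃ ε'.J) (σ' : ε'.J ≃ ε''.J)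
    (ξ : ∀ j, (P.push β).obj (ε.x j) ⟶ ε'.x (σ j))
    (ξ' : ∀ j, (P.push β').obj (ε'.x j) ⟶ ε''.x (σ' j))
    (ξ'' : ∀ j, (P.push (β ≫ β')).obj (ε.x j) ⟶ ε''.x (σ' (σ j)))
    (h : ∀ j, T j ⟶ T' (σ j)) (h' : ∀ j, T' j ⟶ T'' (σ' j))
    (compat : ∀ j, c j ≫ Hom.onRoot (h j) = P.s.map (ξ j).g ≫ c' (σ j))
    (compat' : ∀ j, c' j ≫ Hom.onRoot (h' j) = P.s.map (ξ' j).g ≫ c'' (σ' j))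
    (compat'' : ∀ j, c j ≫ Hom.onRoot (h j ≫ h' (σ j)) = P.s.map (ξ'' j).g ≫ c'' (σ' (σ j))) :
    graftHom hP (β ≫ β') (σ.trans σ') ξ'' (fun j => h j ≫ h' (σ j)) compat'' =
      Hom.comp (graftHom hP β σ ξ h compat) (graftHom hP β' σ' ξ' h' compat') := by
  refine hom_ext ?_ ?_ ?_ ?_ ?_ ?_
  · rintro (_ | ⟨j, a⟩) <;> rfl
  · rintro (j | ⟨j, m⟩) <;> rfl
  · rintro (_ | ⟨j, a⟩) <;> rfl
  · rintro (_ | ⟨j, a⟩)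
    · exact (Category.comp_id _).trans (P.t.map_comp _ _)
    · exact Category.comp_id _
  · rintro (j | ⟨j, a⟩)
    · refine (Category.comp_id _).trans ?_
      refine congrArg GrpdPoly.FibHom.g (hP.thin (ξ'' j)
        (GrpdPoly.fibEq (Category.assoc _ _ _).symm ≫ (P.push β').map (ξ j) ≫ ξ' (σ j))) |>.trans ?_
      exact Category.id_comp _
    · exact Category.comp_id _
  · rintro (_ | ⟨j, a⟩)
    · exact Category.comp_id _
    · exact Category.comp_id _

end PTree

namespace GrpdPoly

variable {P : GrpdPoly I}

/-- The bijection between enumerations of the fibres induced by `β_! : E_b ⥤ E_{b'}`. -/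
noncomputable def Enum.perm {b b' : P.B} (ε : P.Enum b) (ε' : P.Enum b') (β : b ⟶ b') : ε.J ≃ ε'.J where
  toFun j := ε'.lab ((P.push β).obj (ε.x j))
  invFun j := ε.lab ((P.push (inv β)).obj (ε'.x j))
  left_inv j := by
    change ε.lab ((P.push (inv β)).obj (ε'.x (ε'.lab ((P.push β).obj (ε.x j))))) = j
    rw [← ε.lab_eq ((P.push (inv β)).map (ε'.iso ((P.push β).obj (ε.x j)))),
      ← ε.lab_eq (fibEq (show (ε.x j).φ = ((ε.x j).φ ≫ β) ≫ inv β by simp))]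
    exact ε.lab_x j
  right_inv j := by
    change ε'.lab ((P.push β).obj (ε.x (ε.lab ((P.push (inv β)).obj (ε'.x j))))) = j
    rw [← ε'.lab_eq ((P.push β).map (ε.iso ((P.push (inv β)).obj (ε'.x j)))),
      ← ε'.lab_eq (fibEq (show (ε'.x j).φ = ((ε'.x j).φ ≫ inv β) ≫ β by simp))]
    exact ε'.lab_x j

/-- The comparison of representatives. -/
def Enum.permIso {b b' : P.B} (ε : P.Enum b) (ε' : P.Enum b') (β : b ⟶ b') (j : ε.J) :
    (P.push β).obj (ε.x j) ⟶ ε'.x (ε.perm ε' β j) :=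
  ε'.iso ((P.push β).obj (ε.x j))

theorem eqToHom_family {C J : Type*} [Category C] {b : P.B} (f : P.Fib b ⥤ C) (x : J → P.Fib b)
    {i j : J} (h : i = j) :
    eqToHom (congrArg (fun j => f.obj (x j)) h) = f.map (eqToHom (congrArg x h)) := by
  subst h
  simp

/-- Grafting on objects: an object `(b, f)` of `P(W)`, with `f : E_b ⥤ W` a map over `I`, is sent
to the tree obtained by grafting the trees `f(e)`, `e ∈ E_b`, onto the `P`-corolla `b`. -/
@[reducible]
noncomputable def graftObj (hP : P.Finitary) (w : P.Obj P.trees) : PTree P :=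
  PTree.graftFamily hP (hP.enum w.b) (fun j => w.f.obj ((hP.enum w.b).x j))
    (fun j => w.tri ((hP.enum w.b).x j))

/-- The isomorphism from the `j`-th tree of the family `(b, f)` to the corresponding tree of the
family `(b', f')` given by an arrow `(b, f) ⟶ (b', f')` of `P(W)`. -/
noncomputable def graftLeg (hP : P.Finitary) {w w' : P.Obj P.trees} (k : ObjHom w w')
    (j : (hP.enum w.b).J) : w.f.obj ((hP.enum w.b).x j) ⟶
      w'.f.obj ((hP.enum w'.b).x ((hP.enum w.b).perm (hP.enum w'.b) k.β j)) :=
  k.γ.app ((hP.enum w.b).x j) ≫ w'.f.map ((hP.enum w.b).permIso (hP.enum w'.b) k.β j)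

theorem graftLeg_compat (hP : P.Finitary) {w w' : P.Obj P.trees} (k : ObjHom w w')
    (j : (hP.enum w.b).J) :
    w.tri ((hP.enum w.b).x j) ≫ PTree.Hom.onRoot (graftLeg hP k j) =
      P.s.map ((hP.enum w.b).permIso (hP.enum w'.b) k.β j).g ≫
        w'.tri ((hP.enum w'.b).x ((hP.enum w.b).perm (hP.enum w'.b) k.β j)) := by
  have h₁ := k.compat ((hP.enum w.b).x j)
  have h₂ := w'.natural ((hP.enum w.b).permIso (hP.enum w'.b) k.β j)
  rw [graftLeg, PTree.onRoot_comp, h₂, ← h₁]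
  exact (Category.assoc _ _ _).symm

/-- Grafting on arrows. -/
@[reducible]
noncomputable def graftMap (hP : P.Finitary) {w w' : P.Obj P.trees} (k : ObjHom w w') :
    PTree.Hom (graftObj hP w) (graftObj hP w') :=
  PTree.graftHom hP k.β ((hP.enum w.b).perm (hP.enum w'.b) k.β)
    ((hP.enum w.b).permIso (hP.enum w'.b) k.β) (graftLeg hP k) (graftLeg_compat hP k)

theorem Finitary.map_cycle (hP : P.Finitary) {C : Type*} [Category C] {b : P.B} (F : P.Fib b ⥤ C)
    {k l m : P.Fib b} (f : k ⟶ l) (g : l ⟶ m) (h : m ⟶ k) :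
    (F.map f ≫ F.map g) ≫ F.map h = 𝟙 (F.obj k) := by
  rw [← F.map_comp, ← F.map_comp, hP.thin ((f ≫ g) ≫ h) (𝟙 k), F.map_id]

theorem Finitary.leg_aux (hP : P.Finitary) {C : Type*} [Category C] {b b' : P.B} {β : b ⟶ b'}
    {F : P.Fib b ⥤ C} {G : P.Fib b' ⥤ C} (l : F ⟶ P.push β ⋙ G) {c : C} {k m : P.Fib b}
    (f : c ⟶ F.obj k) {u v w : P.Fib b'} (ξ : k ⟶ m) (p : (P.push β).obj k ⟶ u) (q : u ⟶ v)
    (r : v ⟶ w) (n : (P.push β).obj m ⟶ w) :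
    ((f ≫ l.app k ≫ G.map p) ≫ G.map q) ≫ G.map r = (f ≫ F.map ξ) ≫ l.app m ≫ G.map n := by
  have h := l.naturality ξ
  have h' : p ≫ q ≫ r = (P.push β).map ξ ≫ n := hP.thin _ _
  simp only [Category.assoc]
  rw [reassoc_of% h]
  simp only [← G.map_comp]
  rw [h']

theorem graftMap_id (hP : P.Finitary) (w : P.Obj P.trees) :
    graftMap hP (idHom w) = 𝟙 (graftObj hP w) := by
  have hσ : ∀ j, (hP.enum w.b).perm (hP.enum w.b) (𝟙 w.b) j = Equiv.refl _ j := fun j => by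
    refine ((hP.enum w.b).lab_eq (fibEq (Category.comp_id _).symm)).symm.trans
      ((hP.enum w.b).lab_x j)
  have compat : ∀ j, w.tri ((hP.enum w.b).x j) ≫
      PTree.Hom.onRoot (𝟙 (w.f.obj ((hP.enum w.b).x j))) =
      P.s.map (fibEq (P := P) (Category.comp_id ((hP.enum w.b).x j).φ)).g ≫
        w.tri ((hP.enum w.b).x j) := fun j => by
    rw [PTree.onRoot_id]
    simp
  refine Eq.trans ?_ (PTree.graftHom_id hP (fun j => fibEq (Category.comp_id _)) compat)
  refine PTree.graftHom_congr hP rfl hσ fun j => ?_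
  refine (congrArg _ (eqToHom_family w.f (hP.enum w.b).x (hσ j))).trans ?_
  exact hP.map_cycle w.f _ _ _

/-- The composite of two comparisons of representatives. -/
noncomputable def permIsoComp {b b' b'' : P.B} (ε : P.Enum b) (ε' : P.Enum b') (ε'' : P.Enum b'')
    (β : b ⟶ b') (β' : b' ⟶ b'') (j : ε.J) :
    (P.push (β ≫ β')).obj (ε.x j) ⟶ ε''.x (ε'.perm ε'' β' (ε.perm ε' β j)) :=
  fibEq (Category.assoc _ _ _).symm ≫ (P.push β').map (ε.permIso ε' β j) ≫
    ε'.permIso ε'' β' (ε.perm ε' β j)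

theorem permIsoComp_g {b b' b'' : P.B} (ε : P.Enum b) (ε' : P.Enum b') (ε'' : P.Enum b'')
    (β : b ⟶ b') (β' : b' ⟶ b'') (j : ε.J) :
    (permIsoComp ε ε' ε'' β β' j).g =
      (ε.permIso ε' β j).g ≫ (ε'.permIso ε'' β' (ε.perm ε' β j)).g :=
  Category.id_comp _

theorem perm_comp {b b' b'' : P.B} (ε : P.Enum b) (ε' : P.Enum b') (ε'' : P.Enum b'')
    (β : b ⟶ b') (β' : b' ⟶ b'') (j : ε.J) :
    ε.perm ε'' (β ≫ β') j = (ε.perm ε' β).trans (ε'.perm ε'' β') j :=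
  (ε''.lab_eq (permIsoComp ε ε' ε'' β β' j)).trans (ε''.lab_x _)

theorem graftLeg_comp_compat (hP : P.Finitary) {w w' w'' : P.Obj P.trees} (k : ObjHom w w')
    (l : ObjHom w' w'') (j : (hP.enum w.b).J) :
    w.tri ((hP.enum w.b).x j) ≫ PTree.Hom.onRoot
      (graftLeg hP k j ≫ graftLeg hP l ((hP.enum w.b).perm (hP.enum w'.b) k.β j)) =
    P.s.map (permIsoComp (hP.enum w.b) (hP.enum w'.b) (hP.enum w''.b) k.β l.β j).g ≫
      w''.tri ((hP.enum w''.b).x ((hP.enum w'.b).perm (hP.enum w''.b) l.β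
        ((hP.enum w.b).perm (hP.enum w'.b) k.β j))) := by
  have h₁ := graftLeg_compat hP k j
  have h₂ := graftLeg_compat hP l ((hP.enum w.b).perm (hP.enum w'.b) k.β j)
  rw [PTree.onRoot_comp, reassoc_of% h₁, h₂, permIsoComp_g, P.s.map_comp, Category.assoc]

theorem graftLeg_comp (hP : P.Finitary) {w w' w'' : P.Obj P.trees} (k : ObjHom w w')
    (l : ObjHom w' w'') (j : (hP.enum w.b).J) :
    graftLeg hP (compHom k l) j ≫ w''.f.map (eqToHom (congrArg (hP.enum w''.b).x
      (perm_comp (hP.enum w.b) (hP.enum w'.b) (hP.enum w''.b) k.β l.β j))) =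
    graftLeg hP k j ≫ graftLeg hP l ((hP.enum w.b).perm (hP.enum w'.b) k.β j) :=
  hP.leg_aux l.γ (k.γ.app ((hP.enum w.b).x j)) _ _ _ _ _

theorem graftMap_comp (hP : P.Finitary) {w w' w'' : P.Obj P.trees} (k : ObjHom w w')
    (l : ObjHom w' w'') :
    graftMap hP (compHom k l) = PTree.Hom.comp (graftMap hP k) (graftMap hP l) := by
  have h₁ := PTree.graftHom_comp hP (c := fun j => w.tri ((hP.enum w.b).x j))
    (c' := fun j => w'.tri ((hP.enum w'.b).x j)) (c'' := fun j => w''.tri ((hP.enum w''.b).x j))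
    (T := fun j => w.f.obj ((hP.enum w.b).x j)) (T' := fun j => w'.f.obj ((hP.enum w'.b).x j))
    (T'' := fun j => w''.f.obj ((hP.enum w''.b).x j)) k.β l.β ((hP.enum w.b).perm (hP.enum w'.b) k.β)
    ((hP.enum w'.b).perm (hP.enum w''.b) l.β) ((hP.enum w.b).permIso (hP.enum w'.b) k.β)
    ((hP.enum w'.b).permIso (hP.enum w''.b) l.β)
    (permIsoComp (hP.enum w.b) (hP.enum w'.b) (hP.enum w''.b) k.β l.β)
    (graftLeg hP k) (graftLeg hP l) (graftLeg_compat hP k) (graftLeg_compat hP l)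
    (graftLeg_comp_compat hP k l)
  refine Eq.trans ?_ h₁
  refine PTree.graftHom_congr hP rfl
    (perm_comp (hP.enum w.b) (hP.enum w'.b) (hP.enum w''.b) k.β l.β) fun j => ?_
  have h₂ := eqToHom_family w''.f (hP.enum w''.b).x
    (perm_comp (hP.enum w.b) (hP.enum w'.b) (hP.enum w''.b) k.β l.β j)
  have h₃ := graftLeg_comp hP k l j
  exact (congrArg (fun z => graftLeg hP (compHom k l) j ≫ z) h₂).trans h₃

/-- Grafting, as an arrow `P(W) → W` of the homotopy slice. -/
noncomputable def graftArrow (hP : P.Finitary) : GrpdOver.Hom (P.obj P.trees) P.trees where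
  F :=
    { obj := fun w => graftObj hP w
      map := fun k => graftMap hP k
      map_id := fun w => graftMap_id hP w
      map_comp := fun k l => graftMap_comp hP k l }
  tri :=
    { app := fun w => 𝟙 (P.t.obj w.b)
      naturality := fun w w' k => by
        exact (Category.comp_id _).trans
          ((Category.id_comp _).trans (Category.comp_id _)).symm }

open GrpdOver

variable (P : GrpdPoly I) {X : GrpdOver.{y₁, x₁} I} {Y : GrpdOver.{y₂, x₂} I}

/-- The endofunctor `1 + P` of the homotopy slice on objects, where `1` is the constant functor
with value the terminal object `id : I → I`. -/
@[reducible]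
def onePlus (X : GrpdOver.{y, x} I) : GrpdOver.{max u v y, max u v x y} I :=
  sum (one I) (P.obj X)

/-- The endofunctor `1 + P` on arrows. -/
def onePlusMap (f : Hom X Y) : Hom (P.onePlus X) (P.onePlus Y) :=
  (GrpdOver.idHom (one I)).sumMap (P.map f)

/-- The endofunctor `1 + P` on `2`-cells. -/
def onePlusMap₂ {f g : Hom X Y} (θ : f ⟶ g) : P.onePlusMap f ⟶ P.onePlusMap g :=
  cellSum (𝟙 _) (P.map₂ θ)

theorem onePlusMap₂_id (f : Hom X Y) : P.onePlusMap₂ (𝟙 f) = 𝟙 (P.onePlusMap f) := by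
  refine cell_ext (NatTrans.ext (funext fun c => ?_))
  rcases c with c | w
  · rfl
  · exact congrArg (fun k => (Sum.inr_ I (P.Obj Y)).map ((Cell.τ k).app w)) (map₂_id f)

theorem onePlusMap₂_comp {f g h : Hom X Y} (θ : f ⟶ g) (θ' : g ⟶ h) :
    P.onePlusMap₂ (θ ≫ θ') = P.onePlusMap₂ θ ≫ P.onePlusMap₂ θ' := by
  refine cell_ext (NatTrans.ext (funext fun c => ?_))
  rcases c with c | w
  · exact congrArg (Sum.inl_ I (P.Obj Y)).map (Category.comp_id (𝟙 c)).symm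
  · exact congrArg (fun k => (Sum.inr_ I (P.Obj Y)).map ((Cell.τ k).app w)) (map₂_comp θ θ')

/-- A `(1 + P)`-algebra: an object `X` of the homotopy slice with an arrow `1 + P(X) → X`. -/
structure Alg (P : GrpdPoly I) where
  X : GrpdOver.{y, x} I
  str : Hom (P.onePlus X) X

variable {P}

/-- A morphism of `(1 + P)`-algebras: an arrow of the homotopy slice together with a specified
invertible `2`-cell filling the square of structure maps. -/
structure AlgHom (A : Alg.{y₁, x₁} P) (A' : Alg.{y₂, x₂} P) where
  f : Hom A.X A'.X
  cell : A.str.comp f ≅ (P.onePlusMap f).comp A'.str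

/-- A `2`-cell between morphisms of `(1 + P)`-algebras: a `2`-cell of the homotopy slice compatible
with the `2`-cells filling the squares. -/
@[ext]
structure AlgCell {A : Alg.{y₁, x₁} P} {A' : Alg.{y₂, x₂} P} (f g : AlgHom A A') where
  θ : f.f ⟶ g.f
  compat : whiskerL A.str θ ≫ g.cell.hom = f.cell.hom ≫ whiskerR (P.onePlusMap₂ θ) A'.str

/-- The mapping groupoid between two `(1 + P)`-algebras. -/
instance (A : Alg.{y₁, x₁} P) (A' : Alg.{y₂, x₂} P) : Category (AlgHom A A') where
  Hom f g := AlgCell f g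
  id f :=
    { θ := 𝟙 f.f
      compat := by
        rw [onePlusMap₂_id, whiskerL_id, whiskerR_id, Category.id_comp, Category.comp_id] }
  comp a b :=
    { θ := a.θ ≫ b.θ
      compat := by
        rw [onePlusMap₂_comp, whiskerL_comp, whiskerR_comp, Category.assoc, b.compat,
          ← Category.assoc, a.compat, Category.assoc] }
  id_comp a := AlgCell.ext (Category.id_comp a.θ)
  comp_id a := AlgCell.ext (Category.comp_id a.θ)
  assoc a b c := AlgCell.ext (Category.assoc a.θ b.θ c.θ)

/-- A `(1 + P)`-algebra is homotopy initial if the groupoid of morphisms into any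
`(1 + P)`-algebra is contractible, that is, equivalent to a singleton. -/
def Alg.IsHomotopyInitial (A : Alg.{y₁, x₁} P) : Prop :=
  ∀ A' : Alg.{y₂, x₂} P, Nonempty (AlgHom A A' ≌ Discrete PUnit.{1})

/-- The groupoid of `P`-trees as a `(1 + P)`-algebra: the structure map sends `i ∈ I` to the
trivial `P`-tree on `i`, and grafts a family `f : E_b ⥤ W` of `P`-trees onto the `P`-corolla `b`. -/
noncomputable def treeAlg (P : GrpdPoly I) (hP : P.Finitary) : Alg P where
  X := P.trees
  str := (PTree.trivialArrow P).copair (graftArrow hP)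

end GrpdPoly


end

/-! A `P`-tree is either a single edge or has a node at its root. In the second case it is
determined by the decoration `b` of that node and by the branches above its inputs, a family indexed
by the homotopy fibre `E_b`. This is why the structure map `1 + P(W) → W` is an equivalence.
Homotopy initiality needs only one further fact about trees: each branch has fewer nodes than the
tree.

Initiality is proved in `Alg.Rank.isHomotopyInitial` for every algebra whose structure map is an
equivalence and which carries an isomorphism-invariant rank in `ℕ` that increases strictly from the
constituents of an object to the object. Through the inverse of the structure map, the objects of
rank `n` unfold to `1 + P` of the objects of rank less than `n`. A morphism to another algebra is
therefore defined on rank `n` from its restriction to smaller ranks. No arrow joins objects of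
different rank, so the pieces glue without any coherence condition. The same unfolding turns
compatibility of a `2`-cell with the algebra structures into an equation that expresses its rank `n`
part through the lower ones (`compat_iff`). Since all `2`-cells are invertible, this recursion has
exactly one solution. The groupoid of morphisms is thus nonempty with exactly one arrow between any
two objects, that is, contractible.

Full faithfulness of the structure map rests on `FinTree.exists_graft_iso`: an isomorphism of
grafted trees fixes the root, hence the root node; it permutes the inputs of that node and, by
induction from the root, carries branches onto branches. Finite discrete fibres are thin, so a
natural transformation out of `E_b` is determined by its components at representatives, and these
may be chosen freely.

Essential surjectivity cuts a tree at its root node, each edge being colored by the input of this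
node through which its walk to the root passes (`FinTree.IsColoring`). The homotopy pullback
condition matches these inputs with the isomorphism classes of `E_b`. -/

namespace GrpdOver

variable {I : Type u} [Groupoid.{v} I]

/-! ### Invertible `2`-cells and lifting along fully faithful arrows -/

section

variable {X : GrpdOver.{y₁, x₁} I} {Y : GrpdOver.{y₂, x₂} I} {Z : GrpdOver.{y₃, x₃} I}
  {W : GrpdOver.{y₄, x₄} I}

theorem Cell.compat_app {f g : Hom X Y} (a : f ⟶ g) (c : X.C) :
    f.tri.app c ≫ Y.π.map (a.τ.app c) = g.tri.app c :=
  congrArg (fun k => NatTrans.app k c) a.compat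

/-- A `2`-cell of the homotopy slice from its components. -/
def mkCell {f g : Hom X Y} (τ : ∀ c, f.F.obj c ⟶ g.F.obj c)
    (nat : ∀ {c d : X.C} (k : c ⟶ d), f.F.map k ≫ τ d = τ c ≫ g.F.map k)
    (compat : ∀ c, f.tri.app c ≫ Y.π.map (τ c) = g.tri.app c) : f ⟶ g :=
  ⟨⟨τ, fun _ _ k => nat k⟩, NatTrans.ext (funext compat)⟩

instance : IsGroupoid (Hom X Y) where
  all_isIso {f g} a := by
    have : IsIso a.τ := NatIso.isIso_of_isIso_app _
    let b : g ⟶ f := ⟨inv a.τ, by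
      ext c
      have := a.compat_app c
      simp [← this]⟩
    exact ⟨⟨b, cell_ext (IsIso.hom_inv_id a.τ), cell_ext (IsIso.inv_hom_id a.τ)⟩⟩

/-- Two arrows of the homotopy slice are isomorphic. -/
def Hom.Equiv (f g : Hom X Y) : Prop := Nonempty (f ⟶ g)

theorem Hom.Equiv.symm {f g : Hom X Y} : f.Equiv g → g.Equiv f := fun ⟨a⟩ => ⟨inv a⟩

theorem Hom.Equiv.trans {f g h : Hom X Y} : f.Equiv g → g.Equiv h → f.Equiv h :=
  fun ⟨a⟩ ⟨b⟩ => ⟨a ≫ b⟩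

theorem Hom.Equiv.whiskerR {f g : Hom X Y} (h : Hom Y Z) :
    f.Equiv g → (f.comp h).Equiv (g.comp h) := fun ⟨a⟩ => ⟨GrpdOver.whiskerR a h⟩

theorem Hom.Equiv.whiskerL (f : Hom X Y) {g h : Hom Y Z} :
    g.Equiv h → (f.comp g).Equiv (f.comp h) := fun ⟨a⟩ => ⟨GrpdOver.whiskerL f a⟩

theorem Hom.mk_congr {F : X.C ⥤ Y.C} {t s : X.π ⟶ F ⋙ Y.π} (h : ∀ c, t.app c = s.app c) :
    Hom.mk F t = Hom.mk F s := by
  obtain rfl : t = s := NatTrans.ext (funext h)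
  rfl

/-- Composition of functors is associative by definition, so only the triangles have to be compared.
Having an equality rather than a `2`-cell allows rewriting in the chains of `Hom.Equiv` below. -/
theorem comp_assoc (f : Hom X Y) (g : Hom Y Z) (h : Hom Z W) :
    (f.comp g).comp h = f.comp (g.comp h) :=
  Hom.mk_congr fun _ => Category.assoc _ _ _

theorem idHom_comp (f : Hom X Y) : (idHom X).comp f = f :=
  Hom.mk_congr fun _ => Category.id_comp _

theorem comp_idHom (f : Hom X Y) : f.comp (idHom Y) = f :=
  Hom.mk_congr fun _ => Category.comp_id _

/-- Lifting of an arrow along a fully faithful one. -/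
theorem exists_lift (k : Hom Y Z) [k.F.Full] [k.F.Faithful] (h : Hom X Z)
    (H : ∀ c, ∃ d, Nonempty (k.F.obj d ⟶ h.F.obj c)) : ∃ l : Hom X Y, (l.comp k).Equiv h := by
  choose o e using H
  let e := fun c => (e c).some
  refine ⟨
    { F :=
        { obj := o
          -- The functor is `h.F` conjugated by the chosen isomorphisms `e` and pulled back along
          -- `k.F`; with this choice `e` itself is natural.
          map := fun {c d} g => k.F.preimage (e c ≫ h.F.map g ≫ inv (e d))
          map_id := fun c => k.F.map_injective (by simp)
          map_comp := fun g g' => k.F.map_injective (by simp) }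
      tri :=
        { app := fun c => h.tri.app c ≫ Z.π.map (inv (e c)) ≫ inv (k.tri.app (o c))
          naturality := fun c d g => ?_ } }, ⟨mkCell e ?_ ?_⟩⟩
  · have h₁ := k.tri.naturality (k.F.preimage (e c ≫ h.F.map g ≫ inv (e d)))
    have h₂ := h.tri.naturality g
    simp only [Functor.comp_map, Functor.map_preimage] at h₁ h₂ ⊢
    rw [reassoc_of% h₂, ← cancel_mono (k.tri.app (o d))]
    simp [h₁]
  · intro c d g
    simp [Hom.comp]
  · intro c
    simp [Hom.comp]

/-- Lifting of a `2`-cell along a fully faithful arrow. -/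
theorem Hom.Equiv.of_comp (k : Hom Y Z) [k.F.Full] [k.F.Faithful] {l l' : Hom X Y} :
    (l.comp k).Equiv (l'.comp k) → l.Equiv l' := fun ⟨a⟩ => by
  refine ⟨mkCell (fun c => k.F.preimage (a.τ.app c)) (fun {c d} g => ?_) fun c => ?_⟩
  · have h := a.τ.naturality g
    apply k.F.map_injective
    simpa [Hom.comp] using h
  · have h := a.compat_app c
    have h' := (k.tri.naturality (k.F.preimage (a.τ.app c))).trans
      (congrArg (fun z => k.tri.app (l.F.obj c) ≫ Z.π.map z) (k.F.map_preimage (a.τ.app c)))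
    refine (cancel_mono (k.tri.app (l'.F.obj c))).1 ?_
    rw [Category.assoc, h', ← Category.assoc]
    exact h

/-- The inverse is a lift of the identity of `Y` along `k`. The other composite is compared with the
identity of `X` after composing with `k`, which reflects isomorphism of arrows. -/
theorem isEquiv_of_fullyFaithful_essSurj (k : Hom X Y) [k.F.Full] [k.F.Faithful]
    (H : ∀ c, ∃ d, Nonempty (k.F.obj d ⟶ c)) :
    ∃ l : Hom Y X, (k.comp l).Equiv (idHom X) ∧ (l.comp k).Equiv (idHom Y) := by
  obtain ⟨l, hl⟩ := exists_lift k (idHom Y) H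
  refine ⟨l, .of_comp k ?_, hl⟩
  rw [comp_assoc, idHom_comp]
  simpa only [comp_idHom] using hl.whiskerL k

/-! ### Full subgroupoids and gluing along an invariant function -/

/-- The full subgroupoid of the objects that satisfy `Q`, as an object of the homotopy slice. -/
@[reducible]
def sub (X : GrpdOver.{y₁, x₁} I) (Q : ObjectProperty X.C) : GrpdOver.{y₁, x₁} I where
  C := Q.FullSubcategory
  grpd := ⟨fun f => (ObjectProperty.isIso_hom_iff f).1 inferInstance⟩
  π := Q.ι ⋙ X.π

/-- The inclusion of a full subgroupoid. -/
def subι (X : GrpdOver.{y₁, x₁} I) (Q : ObjectProperty X.C) : Hom (X.sub Q) X := ⟨Q.ι, 𝟙 _⟩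

instance (Q : ObjectProperty X.C) : (X.subι Q).F.Full := Q.full_ι

instance (Q : ObjectProperty X.C) : (X.subι Q).F.Faithful := Q.faithful_ι

/-- The restriction of an arrow to full subgroupoids. -/
def Hom.restrict (f : Hom X Y) (Q : ObjectProperty X.C) (R : ObjectProperty Y.C)
    (h : ∀ c, Q c → R (f.F.obj c)) : Hom (X.sub Q) (Y.sub R) where
  F := R.lift (Q.ι ⋙ f.F) fun c => h _ c.property
  tri := Functor.whiskerLeft Q.ι f.tri

theorem Hom.restrict_comp_subι (f : Hom X Y) (Q : ObjectProperty X.C) (R : ObjectProperty Y.C)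
    (h : ∀ c, Q c → R (f.F.obj c)) :
    (f.restrict Q R h).comp (Y.subι R) = (X.subι Q).comp f :=
  Hom.mk_congr fun _ => (Category.comp_id _).trans (Category.id_comp _).symm

section fibers

variable {K : Type*} (r : X.C → K)

/-- The fibre of an isomorphism-invariant function. -/
@[reducible]
def fiber (X : GrpdOver.{y₁, x₁} I) (r : X.C → K) (k : K) : GrpdOver.{y₁, x₁} I :=
  X.sub fun c => r c = k

/-- The inclusion of a fibre of an isomorphism-invariant function. -/
@[reducible]
def fiberι (X : GrpdOver.{y₁, x₁} I) (r : X.C → K) (k : K) : Hom (X.fiber r k) X :=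
  X.subι fun c => r c = k

variable {r}

/-- An arrow of `X` can be viewed in the fibre over `k` or over `l`, which are different types.
Keeping `k` and `l` as variables lets the equality be eliminated; in `glueHom` they are values of
`r`, where this is impossible. -/
theorem fiber_map_eqToHom (H : ∀ k, Hom (X.fiber r k) Y) {c d : X.C} (g : c ⟶ d) {k l : K}
    (h : k = l) (hc : r c = k) (hd : r d = k) :
    (H k).F.map (X := ⟨c, hc⟩) (Y := ⟨d, hd⟩) (ObjectProperty.homMk g) ≫
      eqToHom (by subst h; rfl) =
    eqToHom (by subst h; rfl) ≫
      (H l).F.map (X := ⟨c, hc.trans h⟩) (Y := ⟨d, hd.trans h⟩) (ObjectProperty.homMk g) := by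
  subst h
  simp

theorem fiber_tri_eqToHom (H : ∀ k, Hom (X.fiber r k) Y) {c : X.C} {k l : K}
    (h : k = l) (hc : r c = k) :
    (H k).tri.app ⟨c, hc⟩ ≫ Y.π.map (eqToHom (by subst h; rfl)) =
      (H l).tri.app ⟨c, hc.trans h⟩ := by
  subst h
  simp

theorem fiber_obj_eq (H : ∀ k, Hom (X.fiber r k) Y) {c : X.C} {k l : K} (h : k = l)
    (hc : r c = k) : (H k).F.obj ⟨c, hc⟩ = (H l).F.obj ⟨c, hc.trans h⟩ := by
  subst h
  rfl

/-- An arrow glued from arrows on the fibres of an isomorphism-invariant function. -/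
def glueHom (hr : ∀ {c d : X.C}, (c ⟶ d) → r c = r d) (H : ∀ k, Hom (X.fiber r k) Y) :
    Hom X Y where
  F :=
    { obj := fun c => (H (r c)).F.obj ⟨c, rfl⟩
      map := fun {c d} g =>
        -- The target `d` is first viewed in the fibre of `c`, where `H (r c)` applies, and its
        -- image is then identified with the one computed in the fibre of `d`.
        (H (r c)).F.map (X := ⟨c, rfl⟩) (Y := ⟨d, (hr g).symm⟩) (ObjectProperty.homMk g) ≫
          eqToHom (fiber_obj_eq H (hr g) (hr g).symm)
      map_id := fun c => by
        rw [eqToHom_refl, Category.comp_id]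
        exact (H (r c)).F.map_id _
      map_comp := fun {a b c} f g => by
        rw [Category.assoc, ← reassoc_of% (fiber_map_eqToHom H g (hr f) (hr f).symm
          ((hr g).symm.trans (hr f).symm)), eqToHom_trans, ← Category.assoc]
        congr 1
        exact (H (r a)).F.map_comp (X := ⟨a, rfl⟩) (Y := ⟨b, (hr f).symm⟩)
          (Z := ⟨c, (hr g).symm.trans (hr f).symm⟩) (ObjectProperty.homMk f)
          (ObjectProperty.homMk g) }
  tri :=
    { app := fun c => (H (r c)).tri.app ⟨c, rfl⟩
      naturality := fun c d g => by
        have h := (H (r c)).tri.naturality (X := ⟨c, rfl⟩) (Y := ⟨d, (hr g).symm⟩)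
          (ObjectProperty.homMk g)
        have h' := fiber_tri_eqToHom H (hr g) (hr g).symm
        rw [Functor.comp_map, Functor.map_comp, ← Category.assoc]
        refine Eq.trans ?_ (congrArg (· ≫ _) h)
        rw [Category.assoc]
        exact congrArg (_ ≫ ·) h'.symm }

theorem glueHom_spec (hr : ∀ {c d : X.C}, (c ⟶ d) → r c = r d)
    (H : ∀ k, Hom (X.fiber r k) Y) (k : K) :
    ((X.fiberι r k).comp (glueHom hr H)).Equiv (H k) := by
  refine ⟨mkCell (fun c => eqToHom (fiber_obj_eq H c.property rfl)) ?_ ?_⟩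
  · rintro ⟨c, rfl⟩ ⟨d, hd⟩ g
    refine (Category.assoc _ _ _).trans ((congrArg (_ ≫ ·) (eqToHom_trans _ _)).trans ?_)
    exact (Category.comp_id _).trans (Category.id_comp _).symm
  · rintro ⟨c, rfl⟩
    refine (congrArg (_ ≫ ·) (Y.π.map_id _)).trans ((Category.comp_id _).trans ?_)
    exact Category.id_comp _

/-- A `2`-cell glued from `2`-cells on the fibres of an isomorphism-invariant function. -/
def glueCell (hr : ∀ {c d : X.C}, (c ⟶ d) → r c = r d) {f g : Hom X Y}
    (a : ∀ k, (X.fiberι r k).comp f ⟶ (X.fiberι r k).comp g) : f ⟶ g :=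
  mkCell (fun c => (a (r c)).τ.app ⟨c, rfl⟩)
    (fun {c d} g => by
      have h : ∀ k (h : r d = k), (a (r d)).τ.app ⟨d, rfl⟩ = (a k).τ.app ⟨d, h⟩ := by
        rintro _ rfl; rfl
      rw [h _ (hr g).symm]
      exact (a (r c)).τ.naturality (X := ⟨c, rfl⟩) (Y := ⟨d, (hr g).symm⟩) (ObjectProperty.homMk g))
    (fun c => by
      have h := (a (r c)).compat_app ⟨c, rfl⟩
      refine Eq.trans ?_ (h.trans (Category.id_comp _))
      exact congrArg (· ≫ _) (Category.id_comp _).symm)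

theorem glueCell_app (hr : ∀ {c d : X.C}, (c ⟶ d) → r c = r d) {f g : Hom X Y}
    (a : ∀ k, (X.fiberι r k).comp f ⟶ (X.fiberι r k).comp g) (c : X.C) (k : K) (h : r c = k) :
    (Cell.τ (glueCell hr a)).app c = (a k).τ.app ⟨c, h⟩ := by
  subst h
  rfl

end fibers

end

end GrpdOver

/-! ### Compatibility of `P` and `1 + P` with composition and fully faithful arrows -/

namespace GrpdOver

variable {I : Type u} [Groupoid.{v} I]
variable {X : GrpdOver.{y₁, x₁} I} {Y : GrpdOver.{y₂, x₂} I}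

/-- The `2`-cell with identity components between arrows with the same underlying functor. -/
def strictCell {F : X.C ⥤ Y.C} {t s : X.π ⟶ F ⋙ Y.π} (h : ∀ c, t.app c = s.app c) :
    Hom.mk F t ⟶ Hom.mk F s :=
  mkCell (fun c => 𝟙 (F.obj c)) (fun _ => (Category.comp_id _).trans (Category.id_comp _).symm)
    fun c => (congrArg (_ ≫ ·) (Y.π.map_id _)).trans ((Category.comp_id _).trans (h c))

end GrpdOver

namespace GrpdPoly

open GrpdOver

variable {I : Type u} [Groupoid.{v} I] {P : GrpdPoly I}
variable {X : GrpdOver.{y₁, x₁} I} {Y : GrpdOver.{y₂, x₂} I} {Z : GrpdOver.{y₃, x₃} I}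

/-- The identity arrow between objects of `P(X)` that differ by an equality of triangles. -/
@[reducible]
def ofTri (w : P.Obj X) {tri : ∀ k : P.Fib w.b, P.s.obj k.e ⟶ X.π.obj (w.f.obj k)}
    (natural : ∀ {k l : P.Fib w.b} (g : k ⟶ l), P.s.map g.g ≫ tri l = tri k ≫ X.π.map (w.f.map g))
    (h : w.tri = tri) : ObjHom w ⟨w.b, w.f, tri, natural⟩ where
  β := 𝟙 w.b
  γ := (idHom w).γ
  compat := by
    subst h
    exact (idHom w).compat

/-- Once the equalities of triangles are eliminated, both `ofTri` arrows are identities. -/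
theorem ofTri_natural {w w' : P.Obj X}
    {tri : ∀ k : P.Fib w.b, P.s.obj k.e ⟶ X.π.obj (w.f.obj k)}
    {natural : ∀ {k l : P.Fib w.b} (g : k ⟶ l),
      P.s.map g.g ≫ tri l = tri k ≫ X.π.map (w.f.map g)}
    {tri' : ∀ k : P.Fib w'.b, P.s.obj k.e ⟶ X.π.obj (w'.f.obj k)}
    {natural' : ∀ {k l : P.Fib w'.b} (g : k ⟶ l),
      P.s.map g.g ≫ tri' l = tri' k ≫ X.π.map (w'.f.map g)}
    (h : w.tri = tri) (h' : w'.tri = tri') {β : w.b ⟶ w'.b} {γ : w.f ⟶ P.push β ⋙ w'.f}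
    (compat : ∀ k : P.Fib w.b, w.tri k ≫ X.π.map (γ.app k) = w'.tri ((P.push β).obj k))
    (compat' : ∀ k : P.Fib w.b, tri k ≫ X.π.map (γ.app k) = tri' ((P.push β).obj k)) :
    compHom ⟨β, γ, compat⟩ (ofTri w' natural' h') =
      compHom (ofTri w natural h) (⟨β, γ, compat'⟩ :
        ObjHom ⟨w.b, w.f, tri, natural⟩ ⟨w'.b, w'.f, tri', natural'⟩) := by
  obtain ⟨b, f, t, n⟩ := w
  obtain ⟨b', f', t', n'⟩ := w'
  subst h h'
  let k : (⟨b, f, t, n⟩ : P.Obj X) ⟶ ⟨b', f', t', n'⟩ := ⟨β, γ, compat⟩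
  exact (Category.comp_id k).trans (Category.id_comp k).symm

/-- `P` is compatible with composition of arrows. -/
def mapComp (f : Hom X Y) (g : Hom Y Z) : (P.map f).comp (P.map g) ⟶ P.map (f.comp g) :=
  mkCell
    (fun w => ofTri (mapObj g (mapObj f w)) (mapObj (f.comp g) w).natural
      (funext fun _ => Category.assoc _ _ _))
    (fun {_ _} k => ofTri_natural _ _ (mapHom g (mapHom f k)).compat (mapHom (f.comp g) k).compat)
    (fun w => by
      refine (congrArg (_ ≫ ·) (P.t.map_id _)).trans ((Category.comp_id _).trans ?_)
      exact Category.comp_id _)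

/-- `1 + P` is compatible with composition of arrows. -/
def onePlusComp (f : Hom X Y) (g : Hom Y Z) :
    (P.onePlusMap f).comp (P.onePlusMap g) ⟶ P.onePlusMap (f.comp g) :=
  mkCell
    (fun c => match c with
      | .inl i => (Sum.inl_ I (P.Obj Z)).map (𝟙 i)
      | .inr w => (Sum.inr_ I (P.Obj Z)).map ((mapComp f g).τ.app w))
    (fun {a b} k => match a, b, k with
      | .inl _, .inl _, k => congrArg (Sum.inl_ I (P.Obj Z)).map
          ((Category.comp_id k.down).trans (Category.id_comp k.down).symm)
      | .inr _, .inr _, k =>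
          congrArg (Sum.inr_ I (P.Obj Z)).map ((mapComp f g).τ.naturality k.down))
    (fun c => match c with
      | .inl i => by
        change (𝟙 i ≫ 𝟙 i) ≫ 𝟙 i = 𝟙 i
        simp
      | .inr w => (mapComp f g).compat_app w)

/-- The structure arrows of the fibre are generalized to variables related by equalities.
Eliminating these turns every `fibEq` into an identity and leaves a trivial identity. -/
theorem mapComp_natural_aux (j : Hom X Y) {f g : Hom Y Z} (θ : f ⟶ g) (w : P.Obj X)
    (c : P.Fib w.b) {φ₁ φ₂ φ₃ φ₄ ψ₁ ψ₂ : P.p.obj c.e ⟶ w.b} (h₁ : c.φ = φ₁) (h₂ : φ₁ = φ₂)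
    (h₃ : φ₂ = φ₃) (h₄ : φ₃ = φ₄) (h₅ : c.φ = ψ₁) (h₆ : ψ₁ = ψ₂) (h₇ : ψ₂ = φ₄) :
    ((θ.τ.app (j.F.obj (w.f.obj c)) ≫ g.F.map (j.F.map (w.f.map (fibEq h₁)))) ≫
      g.F.map (j.F.map (w.f.map (fibEq h₂))) ≫ g.F.map (j.F.map (w.f.map (fibEq h₃)))) ≫
        g.F.map (j.F.map (w.f.map (fibEq h₄))) =
    f.F.map (j.F.map (w.f.map (fibEq h₅))) ≫
      (θ.τ.app (j.F.obj (w.f.obj ⟨c.e, ψ₁⟩)) ≫ g.F.map (j.F.map (w.f.map (fibEq h₆)))) ≫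
        g.F.map (j.F.map (w.f.map (fibEq h₇))) := by
  obtain ⟨e, φ⟩ := c
  subst h₁ h₂ h₃ h₄ h₅ h₆
  simp

theorem mapComp_natural (j : Hom X Y) {f g : Hom Y Z} (θ : f ⟶ g) (w : P.Obj X) :
    (P.map₂ θ).τ.app ((P.map j).F.obj w) ≫ (mapComp j g).τ.app w =
      (mapComp j f).τ.app w ≫ (P.map₂ (whiskerL j θ)).τ.app w :=
  objHom_ext rfl fun c => mapComp_natural_aux j θ w c _ _ _ _ _ _ _

theorem onePlusComp_natural (j : Hom X Y) {f g : Hom Y Z} (θ : f ⟶ g) (c : (P.onePlus X).C) :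
    (P.onePlusMap₂ θ).τ.app ((P.onePlusMap j).F.obj c) ≫ (onePlusComp j g).τ.app c =
      (onePlusComp j f).τ.app c ≫ (P.onePlusMap₂ (whiskerL j θ)).τ.app c := by
  rcases c with i | w
  · rfl
  · exact congrArg (Sum.inr_ I (P.Obj Z)).map (mapComp_natural j θ w)

/-- The `2`-cell of an arrow of `P(Y)` is pulled back componentwise along `j`; its naturality and
its compatibility over `I` are reflected because `j` is faithful and its triangle invertible. -/
theorem map_full (j : Hom X Y) [j.F.Full] [j.F.Faithful] : (P.map j).F.Full where
  map_surjective {w w'} k := by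
    refine ⟨⟨k.β, ⟨fun c => j.F.preimage (k.γ.app c), fun c d g => j.F.map_injective ?_⟩,
      fun c => ?_⟩, ?_⟩
    · have h := k.γ.naturality g
      rw [j.F.map_comp, j.F.map_comp]
      refine (congrArg (_ ≫ ·) (j.F.map_preimage _)).trans (h.trans ?_)
      exact (congrArg (· ≫ _) (j.F.map_preimage _)).symm
    · have h := k.compat c
      have h' := (j.tri.naturality (j.F.preimage (k.γ.app c))).trans
        (congrArg (fun z => j.tri.app (w.f.obj c) ≫ Y.π.map z) (j.F.map_preimage (k.γ.app c)))
      refine (cancel_mono (j.tri.app (w'.f.obj ((P.push k.β).obj c)))).1 ?_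
      exact (Category.assoc _ _ _).trans
        ((congrArg (_ ≫ ·) h').trans ((Category.assoc _ _ _).symm.trans h))
    · refine objHom_ext rfl fun c => ?_
      refine (congrArg (_ ≫ ·) ((w'.f ⋙ j.F).map_id _)).trans ((Category.comp_id _).trans ?_)
      exact j.F.map_preimage _

theorem map_faithful (j : Hom X Y) [j.F.Faithful] : (P.map j).F.Faithful where
  map_injective {w w'} k l h := by
    obtain ⟨β, γ, c⟩ := k
    obtain ⟨β', γ', c'⟩ := l
    obtain ⟨h₁, h₂⟩ := ObjHom.mk.inj h
    obtain rfl : β = β' := h₁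
    congr 1
    ext c
    exact j.F.map_injective (congrArg (fun k => NatTrans.app k c) (eq_of_heq h₂))

instance (j : Hom X Y) [j.F.Full] [j.F.Faithful] : (P.onePlusMap j).F.Full where
  map_surjective {a b} k := match a, b, k with
    | .inl _, .inl _, k => ⟨(Sum.inl_ I (P.Obj X)).map k.down, rfl⟩
    | .inr _, .inr _, k => by
      obtain ⟨l, hl⟩ := (map_full (P := P) j).map_surjective k.down
      exact ⟨(Sum.inr_ I (P.Obj X)).map l, congrArg (Sum.inr_ I (P.Obj Y)).map hl⟩

instance (j : Hom X Y) [j.F.Faithful] : (P.onePlusMap j).F.Faithful where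
  map_injective {a b} k l h := match a, b, k, l, h with
    | .inl i, .inl i', k, l, h => by
      have h' : k.down = l.down := congrArg
        (fun z : (.inl i : (P.onePlus Y).C) ⟶ .inl i' => z.down) h
      exact congrArg (Sum.inl_ I (P.Obj X)).map h'
    | .inr _, .inr _, k, l, h => by
      have := (map_faithful (P := P) j).map_injective (congrArg ULift.down h)
      exact congrArg (Sum.inr_ I (P.Obj X)).map this

end GrpdPoly

/-! ### Recursion on rank in a `(1 + P)`-algebra -/

namespace GrpdPoly

open GrpdOver

variable {I : Type u} [Groupoid.{v} I] {P : GrpdPoly I}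

/-- A rank function on a `(1 + P)`-algebra: the structure map strictly increases it. -/
structure Alg.Rank (A : Alg.{y₁, x₁} P) where
  rank : A.X.C → ℕ
  rank_eq : ∀ {c d : A.X.C}, (c ⟶ d) → rank c = rank d
  rank_lt : ∀ (z : P.Obj A.X) (k : P.Fib z.b), rank (z.f.obj k) < rank (A.str.F.obj (.inr z))

/-- In a cube of isomorphisms with four commuting side faces, the two remaining opposite faces
commute together. This moves a compatibility condition along naturality. -/
theorem square_iff {C : Type*} [Category C] [IsGroupoid C] {a a' b b' c c' d d' : C}
    {p : a ⟶ a'} {q : b ⟶ b'} {θ : a ⟶ b} {θ' : a' ⟶ b'} {f : a ⟶ c} {f' : a' ⟶ c'}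
    {g : b ⟶ d} {g' : b' ⟶ d'} {r : c ⟶ c'} {s : d ⟶ d'} {t : c ⟶ d} {t' : c' ⟶ d'}
    (hθ : p ≫ θ' = θ ≫ q) (hf : p ≫ f' = f ≫ r) (hg : q ≫ g' = g ≫ s) (ht : t ≫ s = r ≫ t') :
    θ' ≫ g' = f' ≫ t' ↔ θ ≫ g = f ≫ t := by
  rw [← cancel_epi p, ← cancel_mono s, reassoc_of% hθ, hg, reassoc_of% hf, Category.assoc,
    Category.assoc, ht]

namespace Alg.Rank

variable {A : Alg.{y₁, x₁} P} (ρ : A.Rank)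

/-- The objects of rank less than `n`. -/
@[reducible]
def below (n : ℕ) : GrpdOver.{y₁, x₁} I := A.X.sub fun c => ρ.rank c < n

/-- The inclusion of the objects of rank less than `n`. -/
@[reducible]
def belowι (n : ℕ) : Hom (ρ.below n) A.X := A.X.subι fun c => ρ.rank c < n

/-- The rank of an object of rank less than `n`. -/
@[reducible]
def rankBelow (n : ℕ) (c : (ρ.below n).C) : {m // m < n} := ⟨ρ.rank c.obj, c.property⟩

theorem rankBelow_eq (n : ℕ) {c d : (ρ.below n).C} (f : c ⟶ d) :
    ρ.rankBelow n c = ρ.rankBelow n d := Subtype.ext (ρ.rank_eq f.hom)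

/-- The objects of rank `m`, among those of rank less than `n`. -/
def fiberBelow (n : ℕ) (m : {m // m < n}) :
    Hom ((ρ.below n).fiber (ρ.rankBelow n) m) (A.X.fiber ρ.rank m.1) :=
  (ρ.belowι n).restrict _ _ fun _ h => congrArg Subtype.val h

theorem fiberBelow_comp (n : ℕ) (m : {m // m < n}) :
    (ρ.fiberBelow n m).comp (A.X.fiberι ρ.rank m.1) =
      ((ρ.below n).fiberι (ρ.rankBelow n) m).comp (ρ.belowι n) :=
  Hom.restrict_comp_subι _ _ _ _

/-- An object of rank `n` is isomorphic to a value of the structure map. By strict monotonicity the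
constituents of that value have rank less than `n`, so the inclusion of the fibre lifts along the
fully faithful composite. -/
theorem exists_unfold [A.str.F.Full] [A.str.F.Faithful]
    (hA : ∀ c, ∃ d, Nonempty (A.str.F.obj d ⟶ c)) (n : ℕ) :
    ∃ D : Hom (A.X.fiber ρ.rank n) (P.onePlus (ρ.below n)),
      (D.comp ((P.onePlusMap (ρ.belowι n)).comp A.str)).Equiv (A.X.fiberι ρ.rank n) := by
  have h₁ : ((P.onePlusMap (ρ.belowι n)).comp A.str).F.Full :=
    inferInstanceAs ((P.onePlusMap (ρ.belowι n)).F ⋙ A.str.F).Full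
  have h₂ : ((P.onePlusMap (ρ.belowι n)).comp A.str).F.Faithful :=
    inferInstanceAs ((P.onePlusMap (ρ.belowι n)).F ⋙ A.str.F).Faithful
  refine exists_lift _ _ ?_
  rintro ⟨c, hc⟩
  obtain ⟨i | z, ⟨e⟩⟩ := hA c
  · exact ⟨.inl i, ⟨e⟩⟩
  · have hz : ∀ k, ρ.rank (z.f.obj k) < n := fun k => by
      rw [← hc, ← ρ.rank_eq e]
      exact ρ.rank_lt z k
    let z' : P.Obj (ρ.below n) :=
      { b := z.b
        f := ObjectProperty.lift _ z.f hz
        tri := z.tri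
        natural := z.natural }
    let k : mapObj (ρ.belowι n) z' ⟶ z :=
      ofTri (mapObj (ρ.belowι n) z') z.natural (funext fun c => Category.comp_id (z.tri c))
    exact ⟨.inr z', ⟨A.str.F.map ((Sum.inr_ I (P.Obj A.X)).map k) ≫ e⟩⟩

section

variable [A.str.F.Full] [A.str.F.Faithful] (hA : ∀ c, ∃ d, Nonempty (A.str.F.obj d ⟶ c))

/-- The decomposition of the objects of rank `n`. -/
noncomputable def unfold (n : ℕ) : Hom (A.X.fiber ρ.rank n) (P.onePlus (ρ.below n)) :=
  (ρ.exists_unfold hA n).choose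

/-- The objects of rank `n` are recovered from their decomposition. -/
noncomputable def unfoldCell (n : ℕ) :
    (ρ.unfold hA n).comp ((P.onePlusMap (ρ.belowι n)).comp A.str) ⟶ A.X.fiberι ρ.rank n :=
  (ρ.exists_unfold hA n).choose_spec.some

variable (A' : Alg.{y₂, x₂} P)

/-- The recursively defined arrow, on the objects of rank `n`. -/
noncomputable def recFiber (n : ℕ) : Hom (A.X.fiber ρ.rank n) A'.X :=
  -- The argument of `onePlusMap` is the arrow on all ranks below `n`, glued from the recursive
  -- values; `m` carries the bound that makes the recursion terminate.
  (ρ.unfold hA n).comp ((P.onePlusMap (glueHom (ρ.rankBelow_eq n)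
    fun m => (ρ.fiberBelow n m).comp (recFiber m.1))).comp A'.str)
termination_by n
decreasing_by exact m.2

/-- The recursively defined arrow. -/
noncomputable def recHom : Hom A.X A'.X := glueHom ρ.rank_eq (ρ.recFiber hA A')

/-- This is the recursion equation: the arrow that was glued on the ranks below `n` during the
recursion is isomorphic to the restriction of the final arrow, since both agree on each fibre. -/
theorem fiber_recHom (n : ℕ) : ((A.X.fiberι ρ.rank n).comp (ρ.recHom hA A')).Equiv
    ((ρ.unfold hA n).comp ((P.onePlusMap ((ρ.belowι n).comp (ρ.recHom hA A'))).comp A'.str)) := by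
  refine (glueHom_spec ρ.rank_eq _ n).trans ?_
  rw [recFiber]
  refine .whiskerL _ (.whiskerR _ ?_)
  suffices h : Hom.Equiv (glueHom (ρ.rankBelow_eq n)
      fun m => (ρ.fiberBelow n m).comp (ρ.recFiber hA A' m.1))
      ((ρ.belowι n).comp (ρ.recHom hA A')) from ⟨P.onePlusMap₂ h.some⟩
  refine ⟨glueCell (ρ.rankBelow_eq n) fun m => Nonempty.some (?_ : Hom.Equiv _ _)⟩
  refine (glueHom_spec (ρ.rankBelow_eq n) _ m).trans ?_
  rw [← comp_assoc, ← fiberBelow_comp, comp_assoc]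
  exact .whiskerL _ (glueHom_spec ρ.rank_eq _ m.1).symm

/-- With `D` inverse to the structure map, filling the square for `f` amounts to an isomorphism from
`f` to `D` followed by `1 + P` of `f` and the structure map of `A'`. On each rank this is the
recursion equation, and the ranks glue. -/
theorem exists_algHom (ρ : A.Rank) (hA : ∀ c, ∃ d, Nonempty (A.str.F.obj d ⟶ c)) :
    Nonempty (AlgHom A A') := by
  obtain ⟨D, h₁, h₂⟩ := isEquiv_of_fullyFaithful_essSurj A.str hA
  let f := ρ.recHom hA A'
  have h : f.Equiv (D.comp ((P.onePlusMap f).comp A'.str)) := by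
    refine ⟨glueCell ρ.rank_eq fun n => Nonempty.some (?_ : Hom.Equiv _ _)⟩
    refine (ρ.fiber_recHom hA A' n).trans ?_
    -- The separately chosen unfolding at rank `n` agrees with `D`: after composition with the fully
    -- faithful `A.str`, both become the inclusion of the fibre.
    have h₃ : ((ρ.unfold hA n).comp (P.onePlusMap (ρ.belowι n))).Equiv
        ((A.X.fiberι ρ.rank n).comp D) := by
      refine .of_comp A.str ?_
      rw [comp_assoc, comp_assoc]
      refine Hom.Equiv.trans ⟨ρ.unfoldCell hA n⟩ ?_
      simpa only [comp_idHom] using (h₂.whiskerL (A.X.fiberι ρ.rank n)).symm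
    rw [← comp_assoc (A.X.fiberι ρ.rank n)]
    refine Hom.Equiv.trans ?_ (h₃.whiskerR _)
    rw [comp_assoc, ← comp_assoc (P.onePlusMap _)]
    exact .whiskerL _ (.whiskerR _ (Hom.Equiv.symm ⟨onePlusComp _ _⟩))
  have h' : (A.str.comp f).Equiv ((P.onePlusMap f).comp A'.str) := by
    refine (h.whiskerL A.str).trans ?_
    rw [← comp_assoc]
    simpa only [idHom_comp] using h₁.whiskerR ((P.onePlusMap f).comp A'.str)
  exact ⟨⟨f, asIso h'.some⟩⟩

variable {A'} (f g : AlgHom A A')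

/-- The `2`-cell of a morphism of algebras, in terms of the decomposition of the objects of
rank `n`. -/
noncomputable def unfoldHom (n : ℕ) : (A.X.fiberι ρ.rank n).comp f.f ⟶
    (ρ.unfold hA n).comp ((P.onePlusMap ((ρ.belowι n).comp f.f)).comp A'.str) :=
  inv (whiskerR (ρ.unfoldCell hA n) f.f) ≫
    (strictCell fun _ => (Category.assoc _ _ _).trans (congrArg _ (Category.assoc _ _ _)) :
      ((ρ.unfold hA n).comp ((P.onePlusMap (ρ.belowι n)).comp A.str)).comp f.f ⟶
        (ρ.unfold hA n).comp ((P.onePlusMap (ρ.belowι n)).comp (A.str.comp f.f))) ≫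
    whiskerL (ρ.unfold hA n) (whiskerL (P.onePlusMap (ρ.belowι n)) f.cell.hom ≫
      (strictCell fun _ => (Category.assoc _ _ _).symm :
        (P.onePlusMap (ρ.belowι n)).comp ((P.onePlusMap f.f).comp A'.str) ⟶
          ((P.onePlusMap (ρ.belowι n)).comp (P.onePlusMap f.f)).comp A'.str) ≫
      whiskerR (onePlusComp (ρ.belowι n) f.f) A'.str)

/-- Composing with the image of `unfoldCell` cancels the inverse in `unfoldHom`, and the strict
cells have identity components. Only the cell of `f` and the comparison `onePlusComp` survive. -/
theorem unfoldHom_app (n : ℕ) (c : (A.X.fiber ρ.rank n).C) :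
    f.f.F.map ((ρ.unfoldCell hA n).τ.app c) ≫ (ρ.unfoldHom hA f n).τ.app c =
      f.cell.hom.τ.app ((P.onePlusMap (ρ.belowι n)).F.obj ((ρ.unfold hA n).F.obj c)) ≫
        A'.str.F.map ((onePlusComp (ρ.belowι n) f.f).τ.app ((ρ.unfold hA n).F.obj c)) := by
  have h := congrArg (fun a => NatTrans.app (Cell.τ a) c)
    (IsIso.hom_inv_id (whiskerR (ρ.unfoldCell hA n) f.f))
  refine (Category.assoc _ _ _).symm.trans ((congrArg (· ≫ _) h).trans ?_)
  refine (Category.id_comp _).trans ?_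
  exact (Category.id_comp _).trans (congrArg (_ ≫ ·) (Category.id_comp _))

/-- The `2`-cell over the objects of rank `n` induced by a `2`-cell over the objects of smaller
rank. -/
noncomputable def stepCell {a b : Hom A.X A'.X} (n : ℕ)
    (θ : (ρ.belowι n).comp a ⟶ (ρ.belowι n).comp b) :
    (ρ.unfold hA n).comp ((P.onePlusMap ((ρ.belowι n).comp a)).comp A'.str) ⟶
      (ρ.unfold hA n).comp ((P.onePlusMap ((ρ.belowι n).comp b)).comp A'.str) :=
  whiskerL _ (whiskerR (P.onePlusMap₂ θ) A'.str)

variable {f g}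

/-- Both sides are opposite faces of one cube. Its side faces are naturality of `θ`, the two
instances of `unfoldHom_app`, and naturality of `onePlusComp`. -/
theorem compat_app_iff (θ : f.f ⟶ g.f) (n : ℕ) (c : (A.X.fiber ρ.rank n).C) :
    (whiskerL (A.X.fiberι ρ.rank n) θ ≫ ρ.unfoldHom hA g n).τ.app c =
      (ρ.unfoldHom hA f n ≫ ρ.stepCell hA n (whiskerL (ρ.belowι n) θ)).τ.app c ↔
    (whiskerL A.str θ ≫ g.cell.hom).τ.app
        ((P.onePlusMap (ρ.belowι n)).F.obj ((ρ.unfold hA n).F.obj c)) =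
      (f.cell.hom ≫ whiskerR (P.onePlusMap₂ θ) A'.str).τ.app
        ((P.onePlusMap (ρ.belowι n)).F.obj ((ρ.unfold hA n).F.obj c)) := by
  have hμ := congrArg A'.str.F.map
    (onePlusComp_natural (P := P) (ρ.belowι n) θ ((ρ.unfold hA n).F.obj c))
  exact square_iff (θ.τ.naturality ((ρ.unfoldCell hA n).τ.app c)) (ρ.unfoldHom_app hA f n c)
    (ρ.unfoldHom_app hA g n c)
    ((A'.str.F.map_comp _ _).symm.trans (hμ.trans (A'.str.F.map_comp _ _)))

/-- On the right, the part of `θ` at rank `n` is tied only to its restriction to smaller ranks.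
Existence and uniqueness of algebra `2`-cells both follow by solving this recursion. -/
theorem compat_iff (θ : f.f ⟶ g.f) :
    whiskerL A.str θ ≫ g.cell.hom = f.cell.hom ≫ whiskerR (P.onePlusMap₂ θ) A'.str ↔
      ∀ n, whiskerL (A.X.fiberι ρ.rank n) θ ≫ ρ.unfoldHom hA g n =
        ρ.unfoldHom hA f n ≫ ρ.stepCell hA n (whiskerL (ρ.belowι n) θ) := by
  constructor
  · intro h n
    refine cell_ext (NatTrans.ext (funext fun c => ?_))
    rw [compat_app_iff, h]
  · intro h
    refine cell_ext (NatTrans.ext (funext fun z => ?_))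
    let c : (A.X.fiber ρ.rank (ρ.rank (A.str.F.obj z))).C := ⟨A.str.F.obj z, rfl⟩
    -- The condition is known only at unfolded objects. Every `z` is isomorphic to the unfolding of
    -- its own value under `A.str`, so naturality along `e` transports it to `z`.
    let e : (P.onePlusMap (ρ.belowι _)).F.obj ((ρ.unfold hA _).F.obj c) ⟶ z :=
      A.str.F.preimage ((ρ.unfoldCell hA _).τ.app c)
    have h₁ := (ρ.compat_app_iff hA θ _ c).1 (by rw [h])
    have h₂ := (whiskerL A.str θ ≫ g.cell.hom).τ.naturality e
    have h₃ := (f.cell.hom ≫ whiskerR (P.onePlusMap₂ θ) A'.str).τ.naturality e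
    rw [h₁, ← h₃] at h₂
    exact (cancel_epi _).1 h₂

/-- The restriction of a `2`-cell over the objects of rank `m` to those among the objects of rank
less than `n`. -/
def fiberBelowCell {a b : Hom A.X A'.X} (n : ℕ) (m : {m // m < n})
    (θ : (A.X.fiberι ρ.rank m.1).comp a ⟶ (A.X.fiberι ρ.rank m.1).comp b) :
    ((ρ.below n).fiberι (ρ.rankBelow n) m).comp ((ρ.belowι n).comp a) ⟶
      ((ρ.below n).fiberι (ρ.rankBelow n) m).comp ((ρ.belowι n).comp b) :=
  mkCell (fun c => θ.τ.app ((ρ.fiberBelow n m).F.obj c))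
    (fun k => θ.τ.naturality ((ρ.fiberBelow n m).F.map k))
    (fun c => (Category.assoc _ _ _).trans
      (congrArg (_ ≫ ·) (θ.compat_app ((ρ.fiberBelow n m).F.obj c))))

/-- The component over the objects of rank `n` of the recursively defined `2`-cell. -/
noncomputable def recCell (f g : AlgHom A A') (n : ℕ) :
    (A.X.fiberι ρ.rank n).comp f.f ⟶ (A.X.fiberι ρ.rank n).comp g.f :=
  ρ.unfoldHom hA f n ≫ ρ.stepCell hA n (glueCell (ρ.rankBelow_eq n) fun m =>
    ρ.fiberBelowCell n m (recCell f g m.1)) ≫ inv (ρ.unfoldHom hA g n)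
termination_by n
decreasing_by exact m.2

/-- `recCell` is the equation of `compat_iff` solved for the part at rank `n`, which is possible
because `unfoldHom` is invertible. -/
theorem exists_algCell (ρ : A.Rank) (hA : ∀ c, ∃ d, Nonempty (A.str.F.obj d ⟶ c))
    (f g : AlgHom A A') : Nonempty (f ⟶ g) := by
  let θ : f.f ⟶ g.f := glueCell ρ.rank_eq (ρ.recCell hA f g)
  refine ⟨⟨θ, (ρ.compat_iff hA θ).2 fun n => ?_⟩⟩
  have h₁ : whiskerL (A.X.fiberι ρ.rank n) θ = ρ.recCell hA f g n :=
    cell_ext (NatTrans.ext (funext fun c => glueCell_app ρ.rank_eq _ _ _ c.property))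
  have h₂ : whiskerL (ρ.belowι n) θ = glueCell (ρ.rankBelow_eq n) fun m =>
      ρ.fiberBelowCell n m (ρ.recCell hA f g m.1) := rfl
  rw [h₁, h₂, recCell, Category.assoc, Category.assoc, IsIso.inv_hom_id, Category.comp_id]

/-- By induction on `n` the two cells agree below rank `n`: their values at lower ranks determine
those at rank `n` through `compat_iff`, after cancelling `unfoldHom`. -/
theorem algCell_eq (ρ : A.Rank) (hA : ∀ c, ∃ d, Nonempty (A.str.F.obj d ⟶ c))
    {f g : AlgHom A A'} (a b : f ⟶ g) : a = b := by
  have ha := (ρ.compat_iff hA a.θ).1 a.compat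
  have hb := (ρ.compat_iff hA b.θ).1 b.compat
  have key : ∀ n, whiskerL (ρ.belowι n) a.θ = whiskerL (ρ.belowι n) b.θ := by
    intro n
    induction n with
    | zero => exact cell_ext (NatTrans.ext (funext fun c => (Nat.not_lt_zero _ c.property).elim))
    | succ n ih =>
      have h : whiskerL (A.X.fiberι ρ.rank n) a.θ = whiskerL (A.X.fiberι ρ.rank n) b.θ := by
        rw [← cancel_mono (ρ.unfoldHom hA g n), ha, hb, ih]
      refine cell_ext (NatTrans.ext (funext fun c => ?_))
      rcases Nat.lt_succ_iff_lt_or_eq.1 c.property with hc | hc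
      · exact congrArg (fun k => NatTrans.app (Cell.τ k) (⟨c.obj, hc⟩ : (ρ.below n).C)) ih
      · exact congrArg (fun k => NatTrans.app (Cell.τ k) (⟨c.obj, hc⟩ : (A.X.fiber ρ.rank n).C)) h
  refine AlgCell.ext (cell_ext (NatTrans.ext (funext fun c => ?_)))
  exact congrArg (fun k => NatTrans.app (Cell.τ k)
    (⟨c, Nat.lt_succ_self _⟩ : (ρ.below (ρ.rank c + 1)).C)) (key (ρ.rank c + 1))

end

/-- A ranked algebra whose structure map is an equivalence is homotopy initial. -/
theorem isHomotopyInitial [A.str.F.Full] [A.str.F.Faithful] (ρ : A.Rank)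
    (hA : ∀ c, ∃ d, Nonempty (A.str.F.obj d ⟶ c)) :
    Alg.IsHomotopyInitial.{v, u, y₁, x₁, y₂, x₂} A := fun A' =>
  -- Contractibility means that a morphism exists and that any two are joined by a unique `2`-cell.
  (equiv_punit_iff_unique _).2 ⟨exists_algHom A' ρ hA, fun f g =>
    ⟨⟨⟨(exists_algCell ρ hA f g).some⟩, fun _ => algCell_eq ρ hA _ _⟩⟩⟩

end Alg.Rank

end GrpdPoly

/-! ### Isomorphisms of grafted trees -/

namespace FinTree

/-- Induction on the edges of a tree, from the root. -/
theorem edge_induction (T : FinTree) {Q : T.A → Prop} (root : Q T.root)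
    (step : ∀ m, Q (T.t (T.p m)) → Q (T.s m)) (a : T.A) : Q a := by
  obtain ⟨σ, -, hσ, h⟩ := T.walk
  obtain ⟨k, hk⟩ := h a
  induction k generalizing a with
  | zero => exact (show a = T.root from hk) ▸ root
  | succ k ih =>
    by_cases ha : a = T.root
    · exact ha ▸ root
    · obtain ⟨m, rfl⟩ := T.eq_s_of_ne_root ha
      refine step m ?_
      rw [← hσ]
      exact ih _ hk

theorem some_mk_inj {J : Type*} {A : J → Type*} {j : J} {x y : A j}
    (h : (some ⟨j, x⟩ : Option (Σ j, A j)) = some ⟨j, y⟩) : x = y := by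
  simpa using h

theorem inr_mk_inj {J K : Type*} {A : J → Type*} {j : J} {x y : A j}
    (h : (.inr ⟨j, x⟩ : K ⊕ Σ j, A j) = .inr ⟨j, y⟩) : x = y := by
  simpa using h

/-- Surjectivity on the component `j` uses that `σ` is injective: a preimage of a point over `σ j`
lies over some `j'` with `σ j' = σ j`. -/
theorem exists_optionCongr {J J' : Type*} {A : J → Type*} {A' : J' → Type*} (σ : J ≃ J')
    (e : Option (Σ j, A j) ≃ Option (Σ j, A' j)) (h₀ : e none = none)
    (h : ∀ j x, ∃ y, e (some ⟨j, x⟩) = some ⟨σ j, y⟩) :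
    ∃ f : ∀ j, A j ≃ A' (σ j), e = Equiv.optionCongr (Equiv.sigmaCongr σ f) := by
  choose f hf using h
  refine ⟨fun j => Equiv.ofBijective (f j) ⟨fun x x' hx => ?_, fun y => ?_⟩, ?_⟩
  · have : e (some ⟨j, x⟩) = e (some ⟨j, x'⟩) := by rw [hf, hf, hx]
    simpa using this
  · rcases hz : e.symm (some ⟨σ j, y⟩) with _ | ⟨j', x⟩
    · rw [Equiv.symm_apply_eq, h₀] at hz
      simp at hz
    · rw [Equiv.symm_apply_eq, hf] at hz
      simp only [Option.some.injEq, Sigma.mk.injEq, EmbeddingLike.apply_eq_iff_eq] at hz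
      obtain ⟨rfl, hz⟩ := hz
      exact ⟨x, (eq_of_heq hz).symm⟩
  · ext1 (_ | ⟨j, x⟩)
    · exact h₀
    · exact hf j x

theorem exists_sumCongr {J J' : Type*} {A : J → Type*} {A' : J' → Type*} (σ : J ≃ J')
    (e : J ⊕ (Σ j, A j) ≃ J' ⊕ (Σ j, A' j)) (h₀ : ∀ j, e (.inl j) = .inl (σ j))
    (h : ∀ j x, ∃ y, e (.inr ⟨j, x⟩) = .inr ⟨σ j, y⟩) :
    ∃ f : ∀ j, A j ≃ A' (σ j), e = Equiv.sumCongr σ (Equiv.sigmaCongr σ f) := by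
  choose f hf using h
  refine ⟨fun j => Equiv.ofBijective (f j) ⟨fun x x' hx => ?_, fun y => ?_⟩, ?_⟩
  · have : e (.inr ⟨j, x⟩) = e (.inr ⟨j, x'⟩) := by rw [hf, hf, hx]
    simpa using this
  · rcases hz : e.symm (.inr ⟨σ j, y⟩) with j' | ⟨j', x⟩
    · rw [Equiv.symm_apply_eq, h₀] at hz
      simp at hz
    · rw [Equiv.symm_apply_eq, hf] at hz
      simp only [Sum.inr.injEq, Sigma.mk.injEq, EmbeddingLike.apply_eq_iff_eq] at hz
      obtain ⟨rfl, hz⟩ := hz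
      exact ⟨x, (eq_of_heq hz).symm⟩
  · ext1 (j | ⟨j, x⟩)
    · exact h₀ j
    · exact hf j x

/-- An isomorphism of grafted trees is obtained by grafting isomorphisms. -/
theorem exists_graft_iso {J J' : Type} [Finite J] [Finite J'] {T : J → FinTree} {T' : J' → FinTree}
    (a : (graft T).A ≃ (graft T').A) (m : (graft T).M ≃ (graft T').M)
    (n : (graft T).N ≃ (graft T').N) (ha : a none = none)
    (hs : ∀ i, (graft T').s (m i) = a ((graft T).s i))
    (hp : ∀ i, (graft T').p (m i) = n ((graft T).p i))
    (ht : ∀ i, (graft T').t (n i) = a ((graft T).t i)) :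
    ∃ (σ : J ≃ J') (fa : ∀ j, (T j).A ≃ (T' (σ j)).A) (fm : ∀ j, (T j).M ≃ (T' (σ j)).M)
      (fn : ∀ j, (T j).N ≃ (T' (σ j)).N), a = Equiv.optionCongr (Equiv.sigmaCongr σ fa) ∧
        m = Equiv.sumCongr σ (Equiv.sigmaCongr σ fm) ∧
        n = Equiv.optionCongr (Equiv.sigmaCongr σ fn) := by
  -- The root node is the only node whose output is the root edge.
  have hn : n none = none := by
    have h : (graft T').t (n none) = none := (ht none).trans ha
    rcases h' : n none with _ | ⟨j, x⟩
    · rfl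
    · rw [h'] at h
      simp at h
  -- Inputs of the root node go to inputs of the root node; together with the converse `h₂` this
  -- yields the bijection `σ`.
  have h₁ : ∀ j, ∃ j', m (.inl j) = .inl j' := fun j => by
    have h : (graft T').p (m (.inl j)) = none := (hp (.inl j)).trans hn
    rcases h' : m (.inl j) with j' | ⟨j', x⟩
    · exact ⟨j', rfl⟩
    · rw [h'] at h
      simp at h
  have h₂ : ∀ j', ∃ j, m (.inl j) = .inl j' := fun j' => by
    obtain ⟨i, hi⟩ := m.surjective (.inl j')
    have h := hp i
    rw [hi] at h
    rcases i with j | ⟨j, x⟩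
    · exact ⟨j, hi⟩
    · have := n.injective (hn.trans h)
      simp at this
  choose σ hσ using h₁
  have hσ' : Function.Bijective σ := by
    refine ⟨fun j j' h => ?_, fun j' => ?_⟩
    · have := m.injective ((hσ j).trans ((congrArg Sum.inl h).trans (hσ j').symm))
      simpa using this
    · obtain ⟨j, hj⟩ := h₂ j'
      exact ⟨j, Sum.inl.inj ((hσ j).symm.trans hj)⟩
  let τ := Equiv.ofBijective σ hσ'
  have ht' : ∀ j x, (∃ y, a (some ⟨j, (T j).t x⟩) = some ⟨τ j, y⟩) →
      ∃ y, n (some ⟨j, x⟩) = some ⟨τ j, y⟩ := by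
    rintro j x ⟨y, hy⟩
    have h := (ht (some ⟨j, x⟩)).trans hy
    rcases h' : n (some ⟨j, x⟩) with _ | ⟨j', x'⟩
    · rw [h'] at h
      simp at h
    · rw [h'] at h
      simp only [Option.some.injEq, Sigma.mk.injEq] at h
      obtain ⟨rfl, -⟩ := h
      exact ⟨x', rfl⟩
  have hp' : ∀ j x, (∃ y, n (some ⟨j, (T j).p x⟩) = some ⟨τ j, y⟩) →
      ∃ y, m (.inr ⟨j, x⟩) = .inr ⟨τ j, y⟩ := by
    rintro j x ⟨y, hy⟩
    have h := (hp (.inr ⟨j, x⟩)).trans hy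
    rcases h' : m (.inr ⟨j, x⟩) with j' | ⟨j', x'⟩
    · rw [h'] at h
      simp at h
    · rw [h'] at h
      simp only [Option.some.injEq, Sigma.mk.injEq] at h
      obtain ⟨rfl, -⟩ := h
      exact ⟨x', rfl⟩
  -- Induction from the root of the `j`-th tree, whose root edge follows the input `j`. From an
  -- edge, `ht'` passes to the node with that output, `hp'` to an input of this node, and `hs` to
  -- the edge above it.
  have h₃ : ∀ j x, ∃ y, a (some ⟨j, x⟩) = some ⟨τ j, y⟩ := fun j => by
    refine (T j).edge_induction ?_ fun x hx => ?_
    · have h := hs (.inl j)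
      rw [hσ] at h
      exact ⟨_, h.symm⟩
    · obtain ⟨y, hy⟩ := hp' j x (ht' j _ hx)
      have h := hs (.inr ⟨j, x⟩)
      rw [hy] at h
      exact ⟨_, h.symm⟩
  obtain ⟨fa, hfa⟩ := exists_optionCongr τ a ha h₃
  obtain ⟨fn, hfn⟩ := exists_optionCongr τ n hn fun j x => ht' j x (h₃ j _)
  obtain ⟨fm, hfm⟩ := exists_sumCongr τ m hσ fun j x => hp' j x (ht' j _ (h₃ j _))
  exact ⟨τ, fa, fm, fn, hfa, hfm, hfn⟩

end FinTree

/-! ### Isomorphisms of grafted `P`-trees -/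

variable {I : Type u} [Groupoid.{v} I] {P : GrpdPoly I}

namespace PTree

/-- After the underlying isomorphism is split along the branches, restricting decorations gives `l`,
the new node gives `β`, and its inputs give `ξ`. The square for `t` at the new node forces the
decoration of the root edge to be the image of `β`. -/
theorem exists_graftHom (hP : P.Finitary) {b b' : P.B} {ε : P.Enum b} {ε' : P.Enum b'}
    {T : ε.J → PTree P} {T' : ε'.J → PTree P} {c : ∀ j, P.s.obj (ε.x j).e ⟶ (T j).α (T j).root}
    {c' : ∀ j, P.s.obj (ε'.x j).e ⟶ (T' j).α (T' j).root}
    (h : Hom (graftFamily hP ε T c) (graftFamily hP ε' T' c')) :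
    ∃ (β : b ⟶ b') (σ : ε.J ≃ ε'.J) (ξ : ∀ j, (P.push β).obj (ε.x j) ⟶ ε'.x (σ j))
      (l : ∀ j, T j ⟶ T' (σ j))
      (compat : ∀ j, c j ≫ Hom.onRoot (l j) = P.s.map (ξ j).g ≫ c' (σ j)),
      h = graftHom hP β σ ξ l compat := by
  have hr := root_eq h
  obtain ⟨a, m, n, hs, hp, ht, α, μ, ν, cs, cp, ct⟩ := h
  obtain ⟨σ, fa, fm, fn, rfl, rfl, rfl⟩ := FinTree.exists_graft_iso a m n hr hs hp ht
  let l : ∀ j, T j ⟶ T' (σ j) := fun j =>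
    { a := fa j
      m := fm j
      n := fn j
      hs := fun i => FinTree.some_mk_inj (A := fun j => (T' j).A) (j := σ j) (hs (.inr ⟨j, i⟩))
      hp := fun i => FinTree.some_mk_inj (A := fun j => (T' j).N) (j := σ j) (hp (.inr ⟨j, i⟩))
      ht := fun i => FinTree.some_mk_inj (A := fun j => (T' j).A) (j := σ j) (ht (some ⟨j, i⟩))
      α := fun i => α (some ⟨j, i⟩)
      μ := fun i => μ (.inr ⟨j, i⟩)
      ν := fun i => ν (some ⟨j, i⟩)
      cs := fun i => cs (.inr ⟨j, i⟩)
      cp := fun i => cp (.inr ⟨j, i⟩)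
      ct := fun i => ct (some ⟨j, i⟩) }
  refine ⟨ν none, σ, fun j => ⟨μ (.inl j), ?_⟩, l, fun j => ?_, ?_⟩
  · exact ((cp (.inl j)).trans (congrArg (_ ≫ ·) (Category.comp_id _))).symm
  · have h := cs (.inl j)
    rw [Hom.onRoot, ← Category.assoc, comp_eqToHom_iff, Category.assoc]
    exact h
  · refine hom_ext (fun _ => rfl) (fun _ => rfl) (fun _ => rfl) ?_ ?_ ?_
    · rintro (_ | ⟨j, i⟩)
      · have h := ct none
        refine (Category.comp_id _).trans ((Category.id_comp _).symm.trans (h.trans ?_))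
        exact (congrArg (_ ≫ ·) (Category.id_comp _)).trans (Category.comp_id _)
      · exact Category.comp_id _
    · rintro (j | ⟨j, i⟩) <;> exact Category.comp_id _
    · rintro (_ | ⟨j, i⟩) <;> exact Category.comp_id _

/-- The equality of decorations is part of the conclusion, so the lemma also applies when the index
of a grafted tree reduces to an index of a branch. -/
theorem Hom.congr_α {T T' : PTree P} {h h' : Hom T T'} (e : h = h') (i : T.A) :
    ∃ e' : T'.α (h.a i) = T'.α (h'.a i), h.α i ≫ eqToHom e' = h'.α i := by
  subst e
  exact ⟨rfl, Category.comp_id _⟩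

theorem Hom.congr_μ {T T' : PTree P} {h h' : Hom T T'} (e : h = h') (i : T.M) :
    ∃ e' : T'.μ (h.m i) = T'.μ (h'.m i), h.μ i ≫ eqToHom e' = h'.μ i := by
  subst e
  exact ⟨rfl, Category.comp_id _⟩

theorem Hom.congr_ν {T T' : PTree P} {h h' : Hom T T'} (e : h = h') (i : T.N) :
    ∃ e' : T'.ν (h.n i) = T'.ν (h'.n i), h.ν i ≫ eqToHom e' = h'.ν i := by
  subst e
  exact ⟨rfl, Category.comp_id _⟩

theorem graftHom_injective (hP : P.Finitary) {b b' : P.B} {ε : P.Enum b} {ε' : P.Enum b'}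
    {T : ε.J → PTree P} {T' : ε'.J → PTree P} {c : ∀ j, P.s.obj (ε.x j).e ⟶ (T j).α (T j).root}
    {c' : ∀ j, P.s.obj (ε'.x j).e ⟶ (T' j).α (T' j).root} {β : b ⟶ b'} {σ : ε.J ≃ ε'.J}
    {ξ : ∀ j, (P.push β).obj (ε.x j) ⟶ ε'.x (σ j)} {l l' : ∀ j, T j ⟶ T' (σ j)}
    {compat : ∀ j, c j ≫ Hom.onRoot (l j) = P.s.map (ξ j).g ≫ c' (σ j)}
    {compat' : ∀ j, c j ≫ Hom.onRoot (l' j) = P.s.map (ξ j).g ≫ c' (σ j)}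
    (h : graftHom hP β σ ξ l compat = graftHom hP β σ ξ l' compat') : l = l' := by
  funext j
  refine hom_ext (fun i => ?_) (fun i => ?_) (fun i => ?_) (fun i => ?_) (fun i => ?_)
    (fun i => ?_)
  · exact FinTree.some_mk_inj (A := fun j => (T' j).A) (j := σ j)
      (congrArg (fun k => Hom.a k (some ⟨j, i⟩)) h)
  · exact FinTree.inr_mk_inj (K := ε'.J) (A := fun j => (T' j).M) (j := σ j)
      (congrArg (fun k => Hom.m k (Sum.inr ⟨j, i⟩)) h)
  · exact FinTree.some_mk_inj (A := fun j => (T' j).N) (j := σ j)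
      (congrArg (fun k => Hom.n k (some ⟨j, i⟩)) h)
  · exact (Hom.congr_α h (some ⟨j, i⟩)).choose_spec
  · exact (Hom.congr_μ h (.inr ⟨j, i⟩)).choose_spec
  · exact (Hom.congr_ν h (some ⟨j, i⟩)).choose_spec

end PTree

/-! ### Grafting is fully faithful -/

namespace GrpdPoly

/-- An object of `E_b` is isomorphic to exactly one representative, and parallel arrows in the
fibres are equal, so the choices on either side do not matter. -/
theorem leg_indep (hP : P.Finitary) {C : Type*} [Category C] {b b' : P.B} {ε : P.Enum b}
    {ε' : P.Enum b'} {F : P.Fib b ⥤ C} {G : P.Fib b' ⥤ C} {σ : ε.J → ε'.J}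
    (l : ∀ j, F.obj (ε.x j) ⟶ G.obj (ε'.x (σ j))) {k : P.Fib b} {k' : P.Fib b'} {i j : ε.J}
    (r : k ⟶ ε.x i) (r' : k ⟶ ε.x j) (s : ε'.x (σ i) ⟶ k') (s' : ε'.x (σ j) ⟶ k') :
    F.map r ≫ l i ≫ G.map s = F.map r' ≫ l j ≫ G.map s' := by
  obtain rfl : i = j := by
    rw [← ε.lab_x i, ← ε.lab_x j, ← ε.lab_eq r, ← ε.lab_eq r']
  rw [hP.thin r r', hP.thin s s']

theorem graftArrow_full (hP : P.Finitary) : (graftArrow hP).F.Full where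
  map_surjective {w w'} h := by
    obtain ⟨β, σ, ξ, l, compat, rfl⟩ := PTree.exists_graftHom hP h
    let ε := hP.enum w.b
    let ε' := hP.enum w'.b
    let ζ : ∀ k : P.Fib w.b, ε'.x (σ (ε.lab k)) ⟶ (P.push β).obj k := fun k =>
      inv ((P.push β).map (ε.iso k) ≫ ξ (ε.lab k))
    let k : ObjHom w w' :=
      { β := β
        γ :=
          -- The component at an arbitrary object passes to its representative, applies `l`, and
          -- returns by `ζ`; naturality is independence of the choices.
          { app := fun k => w.f.map (ε.iso k) ≫ l (ε.lab k) ≫ w'.f.map (ζ k)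
            naturality := fun k k' g => by
              rw [Functor.comp_map, ← w.f.map_comp_assoc, Category.assoc, Category.assoc,
                ← w'.f.map_comp]
              exact leg_indep hP (ε := ε) (ε' := ε') l _ _ _ _ }
        compat := fun k => by
          have h₁ := w.natural (ε.iso k)
          have h₂ := compat (ε.lab k)
          have h₃ := w'.natural (ζ k)
          have h₄ : (ε.iso k).g ≫ (ξ (ε.lab k)).g ≫ (ζ k).g = 𝟙 k.e := by
            have := IsIso.hom_inv_id ((P.push β).map (ε.iso k) ≫ ξ (ε.lab k))
            rw [Category.assoc] at this
            exact congrArg FibHom.g this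
          rw [P.trees.π.map_comp, P.trees.π.map_comp, ← reassoc_of% h₁]
          refine (congrArg (_ ≫ ·) (Category.assoc _ _ _).symm).trans ?_
          refine (congrArg (fun z => _ ≫ z ≫ _) h₂).trans ?_
          rw [Category.assoc]
          refine (congrArg (fun z => _ ≫ _ ≫ z) h₃.symm).trans ?_
          rw [← Category.assoc, ← Category.assoc, ← P.s.map_comp, ← P.s.map_comp, Category.assoc]
          exact (congrArg (fun z => P.s.map z ≫ _) h₄).trans
            ((congrArg (· ≫ _) (P.s.map_id _)).trans (Category.id_comp _)) }
    -- `graftMap` uses the bijection induced by `β`, which must be `σ` because `ξ j` identifies the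
    -- image of the `j`-th representative with representative `σ j`.
    have hσ : ∀ j, ε.perm ε' β j = σ j := fun j => (ε'.lab_eq (ξ j)).trans (ε'.lab_x (σ j))
    refine ⟨k, PTree.graftHom_congr hP (compat := graftLeg_compat hP k) rfl hσ fun j => ?_⟩
    refine (congrArg (_ ≫ ·) (eqToHom_family w'.f ε'.x (hσ j))).trans ?_
    have h₁ := leg_indep hP (ε := ε) (ε' := ε') l (ε.iso (ε.x j)) (𝟙 (ε.x j))
      (ζ (ε.x j) ≫ ε.permIso ε' β j ≫ eqToHom (congrArg ε'.x (hσ j))) (𝟙 _)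
    rw [w.f.map_id, w'.f.map_id, Category.id_comp, Category.comp_id] at h₁
    rw [← h₁, w'.f.map_comp, w'.f.map_comp]
    rw [graftLeg, Category.assoc]
    exact (Category.assoc _ _ _).trans (congrArg (_ ≫ ·) (Category.assoc _ _ _))

/-- The decoration of the root node recovers `β`. The branches recover the `2`-cell at
representatives, and naturality extends this to all of `E_b`. -/
theorem graftArrow_faithful (hP : P.Finitary) : (graftArrow hP).F.Faithful where
  map_injective {w w'} k k' h := by
    have hβ : k.β = k'.β := by
      obtain ⟨e, he⟩ := PTree.Hom.congr_ν h none
      exact (Category.comp_id _).symm.trans he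
    obtain ⟨β, γ, h₁⟩ := k
    obtain ⟨β', γ', h₂⟩ := k'
    obtain rfl : β = β' := hβ
    have hl := PTree.graftHom_injective hP (compat := graftLeg_compat hP ⟨β, γ, h₁⟩)
      (compat' := graftLeg_compat hP ⟨β, γ', h₂⟩) h
    congr 1
    ext c
    have h₃ := congrFun hl ((hP.enum w.b).lab c)
    have h₄ := (cancel_mono _).1 h₃
    have h₅ := γ.naturality ((hP.enum w.b).iso c)
    have h₆ := γ'.naturality ((hP.enum w.b).iso c)
    refine (cancel_mono ((P.push β ⋙ w'.f).map ((hP.enum w.b).iso c))).1 ?_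
    rw [← h₅, ← h₆]
    exact congrArg (_ ≫ ·) h₄

end GrpdPoly

/-! ### Recursion from the root, colorings and branches -/

namespace FinTree

/-- Induction from the root suffices to build a walk function, which is easier to verify for a
branch than finite iteration. -/
theorem exists_walk {A M N : Type} {s : M → A} {p : M → N} {t : N → A} {root : A}
    (hs : Function.Injective s) (hr : ∀ m, s m ≠ root)
    (ind : ∀ Q : A → Prop, Q root → (∀ m, Q (t (p m)) → Q (s m)) → ∀ a, Q a) :
    ∃ σ : A → A, σ root = root ∧ (∀ m, σ (s m) = t (p m)) ∧ ∀ a, ∃ k : ℕ, σ^[k] a = root := by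
  classical
  let σ : A → A := fun a => if h : ∃ m, s m = a then t (p h.choose) else root
  have hσ : ∀ m, σ (s m) = t (p m) := fun m => by
    have h : ∃ m', s m' = s m := ⟨m, rfl⟩
    exact (dif_pos h).trans (by rw [hs h.choose_spec])
  refine ⟨σ, dif_neg fun ⟨m, hm⟩ => hr m hm, hσ, ind _ ⟨0, rfl⟩ fun m ⟨k, hk⟩ => ⟨k + 1, ?_⟩⟩
  rw [Function.iterate_succ_apply, hσ, hk]

/-- Functions on the edges of a tree may be defined by recursion from the root. -/
theorem exists_rec (T : FinTree) {C : Type*} (c : C) (step : T.M → C → C) :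
    ∃ f : T.A → C, f T.root = c ∧ ∀ m, f (T.s m) = step m (f (T.t (T.p m))) := by
  classical
  -- The parent relation; every edge is accessible by induction from the root.
  let r : T.A → T.A → Prop := fun a' a => ∃ m, a = T.s m ∧ a' = T.t (T.p m)
  have hr : WellFounded r := ⟨T.edge_induction
    ⟨_, fun a ⟨m, hm, _⟩ => (T.s_ne_root m hm.symm).elim⟩ fun m hm => ⟨_, by
      rintro a ⟨m', h, rfl⟩
      rwa [← T.s_inj h]⟩⟩
  let f : T.A → C := hr.fix fun a ih =>
    if h : ∃ m, T.s m = a then step h.choose (ih _ ⟨h.choose, h.choose_spec.symm, rfl⟩) else c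
  refine ⟨f, ?_, fun m => ?_⟩
  · exact (hr.fix_eq _ _).trans (dif_neg fun ⟨m, hm⟩ => T.s_ne_root m hm)
  · have h : ∃ m', T.s m' = T.s m := ⟨m, rfl⟩
    refine (hr.fix_eq _ _).trans ((dif_pos h).trans ?_)
    change step h.choose (f (T.t (T.p h.choose))) = _
    rw [T.s_inj h.choose_spec]

/-- A function that sends each edge other than the root to the input of the root node `n` through
which its walk to the root passes. -/
structure IsColoring (T : FinTree) (n : T.N) (κ : T.A → Option T.M) : Prop where
  t_eq : T.t n = T.root
  root : κ T.root = none
  input : ∀ m, T.p m = n → κ (T.s m) = some m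
  step : ∀ m, T.p m ≠ n → κ (T.s m) = κ (T.t (T.p m))

theorem exists_coloring (T : FinTree) {n : T.N} (hn : T.t n = T.root) :
    ∃ κ, T.IsColoring n κ := by
  classical
  -- The color starts as `none` at the root, is set to `m` on crossing an input `m` of `n`, and is
  -- inherited at all other nodes.
  obtain ⟨κ, h₁, h₂⟩ := T.exists_rec none fun m c => if T.p m = n then some m else c
  exact ⟨κ, hn, h₁, fun m h => (h₂ m).trans (if_pos h), fun m h => (h₂ m).trans (if_neg h)⟩

namespace IsColoring

variable {T : FinTree} {n : T.N} {κ : T.A → Option T.M}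

theorem eq_root (hκ : T.IsColoring n κ) {a : T.A} : κ a = none → a = T.root := by
  refine T.edge_induction (Q := fun a => κ a = none → a = T.root) (fun _ => rfl)
    (fun m ih h => ?_) a
  by_cases hm : T.p m = n
  · rw [hκ.input m hm] at h
    simp at h
  · rw [hκ.step m hm] at h
    -- An uncolored edge directly below a node is the root edge by induction, so that node is `n`;
    -- but the inputs of `n` are colored.
    exact (hm (T.t_inj ((ih h).trans hκ.t_eq.symm))).elim

theorem p_eq (hκ : T.IsColoring n κ) {a : T.A} {m : T.M} : κ a = some m → T.p m = n := by
  refine T.edge_induction (Q := fun a => κ a = some m → T.p m = n) (fun h => ?_)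
    (fun m' ih h => ?_) a
  · rw [hκ.root] at h
    simp at h
  · by_cases hm : T.p m' = n
    · rw [hκ.input m' hm, Option.some.injEq] at h
      exact h ▸ hm
    · rw [hκ.step m' hm] at h
      exact ih h

end IsColoring

/-- The branch of a tree whose root is the input `m` of the root node. -/
@[reducible]
def branch (T : FinTree) {n : T.N} {κ : T.A → Option T.M} (hκ : T.IsColoring n κ) (m : T.M)
    (hm : T.p m = n) : FinTree where
  A := {a // κ a = some m}
  M := {i // T.p i ≠ n ∧ κ (T.s i) = some m}
  N := {i // κ (T.t i) = some m}
  finA := by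
    have := T.finA
    infer_instance
  finM := by
    have := T.finM
    infer_instance
  finN := by
    have := T.finN
    infer_instance
  s i := ⟨T.s i.1, i.2.2⟩
  p i := ⟨T.p i.1, (hκ.step i.1 i.2.1).symm.trans i.2.2⟩
  t i := ⟨T.t i.1, i.2⟩
  root := ⟨T.s m, hκ.input m hm⟩
  t_inj i j h := Subtype.ext (T.t_inj (congrArg Subtype.val h))
  s_inj i j h := Subtype.ext (T.s_inj (congrArg Subtype.val h))
  compl_s := by
    ext ⟨a, ha⟩
    simp only [Set.mem_compl_iff, Set.mem_range, Set.mem_singleton_iff, Subtype.mk.injEq]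
    constructor
    · intro h
      obtain ⟨i, rfl⟩ := T.eq_s_of_ne_root (a := a) (by
        rintro rfl
        rw [hκ.root] at ha
        simp at ha)
      by_cases hi : T.p i = n
      · rw [hκ.input i hi, Option.some.injEq] at ha
        rw [ha]
      · exact (h ⟨⟨i, hi, ha⟩, rfl⟩).elim
    · rintro rfl ⟨⟨i, hi, _⟩, h⟩
      exact hi ((congrArg T.p (T.s_inj h)).trans hm)
  walk := by
    refine exists_walk (A := {a // κ a = some m}) (M := {i // T.p i ≠ n ∧ κ (T.s i) = some m})
      (N := {i // κ (T.t i) = some m}) (s := fun i => ⟨T.s i.1, i.2.2⟩)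
      (p := fun i => ⟨T.p i.1, (hκ.step i.1 i.2.1).symm.trans i.2.2⟩)
      (t := fun i => ⟨T.t i.1, i.2⟩) (root := ⟨T.s m, hκ.input m hm⟩)
      (fun i j h => Subtype.ext (T.s_inj (congrArg Subtype.val h)))
      (fun i h => i.2.1 ((congrArg T.p (T.s_inj (congrArg Subtype.val h))).trans hm))
      fun Q h₀ h₁ => ?_
    rintro ⟨a, ha⟩
    revert ha
    refine T.edge_induction (Q := fun a => ∀ ha : κ a = some m, Q ⟨a, ha⟩) (fun h => ?_)
      (fun i ih h => ?_) a
    · rw [hκ.root] at h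
      simp at h
    · by_cases hi : T.p i = n
      · have h' := h
        rw [hκ.input i hi, Option.some.injEq] at h'
        subst h'
        exact h₀
      · exact h₁ ⟨i, hi, h⟩ (ih _)

end FinTree

variable {I : Type u} [Groupoid.{v} I] {P : GrpdPoly I}

/-! ### Decomposition of a `P`-tree into its branches -/

namespace PTree

/-- The branch of a `P`-tree whose root is the input `m` of the root node. -/
@[reducible]
def branch (hP : P.Finitary) (T : PTree P) {n : T.N} {κ : T.A → Option T.M}
    (hκ : T.IsColoring n κ) (m : T.M) (hm : T.p m = n) : PTree P where
  toFinTree := T.toFinTree.branch hκ m hm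
  α := fun a : {a // κ a = some m} => T.α a.1
  μ := fun i : {i // T.p i ≠ n ∧ κ (T.s i) = some m} => T.μ i.1
  ν := fun i : {i // κ (T.t i) = some m} => T.ν i.1
  cs := fun i : {i // T.p i ≠ n ∧ κ (T.s i) = some m} => T.cs i.1
  cp := fun i : {i // T.p i ≠ n ∧ κ (T.s i) = some m} => T.cp i.1
  ct := fun i : {i // κ (T.t i) = some m} => T.ct i.1
  cart := by
    refine cart_of hP (M := {i // T.p i ≠ n ∧ κ (T.s i) = some m})
      (N := {i // κ (T.t i) = some m})
      (p := fun i => ⟨T.p i.1, (hκ.step i.1 i.2.1).symm.trans i.2.2⟩)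
      (μ := fun i => T.μ i.1) (ν := fun i => T.ν i.1) (fun i => T.cp i.1) ?_ ?_
    · intro i j h g w
      exact Subtype.ext (T.cart_inj i.1 j.1 (congrArg Subtype.val h) g w)
    · rintro ⟨i, hi⟩ e φ
      obtain ⟨j, rfl, g, w⟩ := T.cart_surj i e φ
      -- The output of the root node is the root edge, which has no color, so this node lies in no
      -- branch.
      have hj : T.p j ≠ n := by
        intro hj
        rw [hj, hκ.t_eq, hκ.root] at hi
        simp at hi
      exact ⟨⟨j, hj, (hκ.step j hj).trans hi⟩, rfl, g, w⟩

/-- The object of the fibre of a node given by an input of this node. -/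
@[reducible]
def inputFib (T : PTree P) {n : T.N} (m : T.M) (hm : T.p m = n) : P.Fib (T.ν n) :=
  ⟨T.μ m, T.cp m ≫ eqToHom (congrArg T.ν hm)⟩

/-- A tree with a root node is obtained by grafting its branches. -/
theorem exists_graft_hom (hP : P.Finitary) (T : PTree P) {n : T.N} {κ : T.A → Option T.M}
    (hκ : T.IsColoring n κ) (ε : P.Enum (T.ν n)) (m : ε.J → T.M) (hm : ∀ j, T.p (m j) = n)
    (inj : Function.Injective m) (surj : ∀ i, T.p i = n → ∃ j, m j = i)
    (ξ : ∀ j, ε.x j ⟶ T.inputFib (m j) (hm j)) :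
    Nonempty (graftFamily hP ε (fun j => T.branch hP hκ (m j) (hm j))
      (fun j => (P.s.map (ξ j).g ≫ T.cs (m j) : P.s.obj (ε.x j).e ⟶ T.α (T.s (m j)))) ⟶ T) := by
  -- The comparison maps include the branches and send the new root and node to those of `T`. They
  -- are bijective because every edge except the root has exactly one color, and `m` enumerates the
  -- colors.
  let fa : (Option (Σ j, {a // κ a = some (m j)})) → T.A := fun a => match a with
    | none => T.root
    | some ⟨_, a⟩ => a.1
  let fm : (ε.J ⊕ Σ j, {i // T.p i ≠ n ∧ κ (T.s i) = some (m j)}) → T.M := fun i => match i with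
    | .inl j => m j
    | .inr ⟨_, i⟩ => i.1
  let fn : (Option (Σ j, {i // κ (T.t i) = some (m j)})) → T.N := fun i => match i with
    | none => n
    | some ⟨_, i⟩ => i.1
  have ha : Function.Bijective fa := by
    refine ⟨?_, fun a => ?_⟩
    · rintro (_ | ⟨j, a, ha⟩) (_ | ⟨j', a', ha'⟩) h
      · rfl
      · obtain rfl : T.root = a' := h
        simp [hκ.root] at ha'
      · obtain rfl : a = T.root := h
        simp [hκ.root] at ha
      · obtain rfl : a = a' := h
        obtain rfl : j = j' := inj (Option.some.inj (ha.symm.trans ha'))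
        rfl
    · rcases h : κ a with _ | i
      · exact ⟨none, (hκ.eq_root h).symm⟩
      · obtain ⟨j, rfl⟩ := surj i (hκ.p_eq h)
        exact ⟨some ⟨j, a, h⟩, rfl⟩
  have hm' : Function.Bijective fm := by
    refine ⟨?_, fun i => ?_⟩
    · rintro (j | ⟨j, i, hi, hi'⟩) (j' | ⟨j', i', hi'', hi'''⟩) h
      · exact congrArg Sum.inl (inj h)
      · obtain rfl : m j = i' := h
        exact (hi'' (hm j)).elim
      · obtain rfl : i = m j' := h
        exact (hi (hm j')).elim
      · obtain rfl : i = i' := h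
        obtain rfl : j = j' := inj (Option.some.inj (hi'.symm.trans hi'''))
        rfl
    · by_cases hi : T.p i = n
      · obtain ⟨j, hj⟩ := surj i hi
        exact ⟨.inl j, hj⟩
      · rcases h : κ (T.s i) with _ | i'
        · exact (T.s_ne_root i (hκ.eq_root h)).elim
        · obtain ⟨j, rfl⟩ := surj i' (hκ.p_eq h)
          exact ⟨.inr ⟨j, i, hi, h⟩, rfl⟩
  have hn : Function.Bijective fn := by
    refine ⟨?_, fun i => ?_⟩
    · rintro (_ | ⟨j, i, hi⟩) (_ | ⟨j', i', hi'⟩) h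
      · rfl
      · obtain rfl : n = i' := h
        simp [hκ.t_eq, hκ.root] at hi'
      · obtain rfl : i = n := h
        simp [hκ.t_eq, hκ.root] at hi
      · obtain rfl : i = i' := h
        obtain rfl : j = j' := inj (Option.some.inj (hi.symm.trans hi'))
        rfl
    · rcases h : κ (T.t i) with _ | i'
      · exact ⟨none, T.t_inj (hκ.t_eq.trans (hκ.eq_root h).symm)⟩
      · obtain ⟨j, rfl⟩ := surj i' (hκ.p_eq h)
        exact ⟨some ⟨j, i, h⟩, rfl⟩
  exact ⟨
    { a := Equiv.ofBijective fa ha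
      m := Equiv.ofBijective fm hm'
      n := Equiv.ofBijective fn hn
      hs := fun i => match i with
        | .inl _ => rfl
        | .inr _ => rfl
      hp := fun i => match i with
        | .inl j => hm j
        | .inr _ => rfl
      ht := fun i => match i with
        | none => hκ.t_eq
        | some _ => rfl
      α := fun a => match a with
        -- Grafting decorates the root by `t` of its node, whereas `T` has its own root decoration;
        -- the specified isomorphism at `n` compares the two.
        | none => T.ct n ≫ eqToHom (congrArg T.α hκ.t_eq)
        | some ⟨_, a, _⟩ => 𝟙 (T.α a)
      μ := fun i => match i with
        | .inl j => (ξ j).g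
        | .inr ⟨_, i, _⟩ => 𝟙 (T.μ i)
      ν := fun i => match i with
        | none => 𝟙 (T.ν n)
        | some ⟨_, i, _⟩ => 𝟙 (T.ν i)
      cs := fun i => match i with
        | .inl _ => Category.assoc _ _ _
        | .inr ⟨_, i, _⟩ => (Hom.id T).cs i
      cp := fun i => match i with
        | .inl j => (Category.comp_id _).trans (ξ j).w.symm
        | .inr ⟨_, i, _⟩ => (Hom.id T).cp i
      ct := fun i => match i with
        | none => (Category.id_comp _).trans
            ((congrArg (· ≫ _) (P.t.map_id _)).trans (Category.id_comp _)).symm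
        | some ⟨_, i, _⟩ => (Hom.id T).ct i }⟩

/-- A tree without a root node is trivial. -/
theorem exists_trivial_hom (T : PTree P) (h : ∀ n, T.t n ≠ T.root) :
    Nonempty (trivial P (T.α T.root) ⟶ T) := by
  have ha : ∀ a, a = T.root :=
    T.edge_induction rfl fun m hm => (h _ hm).elim
  have hM : IsEmpty T.M := ⟨fun m => T.s_ne_root m (ha _)⟩
  have hN : IsEmpty T.N := ⟨fun n => h n (ha _)⟩
  exact ⟨
    { a := ⟨fun _ => T.root, fun _ => (), fun _ => rfl, fun a => (ha a).symm⟩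
      m := Equiv.equivOfIsEmpty _ _
      n := Equiv.equivOfIsEmpty _ _
      hs := fun i => i.elim
      hp := fun i => i.elim
      ht := fun i => i.elim
      α := fun _ => 𝟙 (T.α T.root)
      μ := fun i => i.elim
      ν := fun i => i.elim
      cs := fun i => i.elim
      cp := fun i => i.elim
      ct := fun i => i.elim }⟩

theorem trivialArrow_full (P : GrpdPoly I) : (trivialArrow P).F.Full where
  map_surjective h := ⟨Hom.α h (), hom_ext (fun _ => rfl) (fun m => m.elim)
    (fun m => m.elim) (fun _ => Category.comp_id _) (fun m => m.elim) (fun m => m.elim)⟩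

theorem trivialArrow_faithful (P : GrpdPoly I) : (trivialArrow P).F.Faithful where
  map_injective {_ _} g g' h := by
    obtain ⟨e, he⟩ := Hom.congr_α h ()
    exact (Category.comp_id _).symm.trans he

end PTree

/-! ### The structure map is an equivalence, and trees are ranked by their nodes -/

namespace GrpdPoly

open GrpdOver

instance (hP : P.Finitary) : (treeAlg P hP).str.F.Full where
  map_surjective {a b} h := match a, b, h with
    | .inl _, .inl _, h => by
      obtain ⟨g, hg⟩ := (PTree.trivialArrow_full P).map_surjective h
      exact ⟨(Sum.inl_ I (P.Obj P.trees)).map g, hg⟩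
    -- A grafted tree has a node and a trivial tree has none, so they are never isomorphic.
    | .inl _, .inr _, h => (Equiv.symm (PTree.Hom.n h) none).elim
    | .inr _, .inl _, h => (PTree.Hom.n h none).elim
    | .inr _, .inr _, h => by
      obtain ⟨g, hg⟩ := (graftArrow_full hP).map_surjective h
      exact ⟨(Sum.inr_ I (P.Obj P.trees)).map g, hg⟩

instance (hP : P.Finitary) : (treeAlg P hP).str.F.Faithful where
  map_injective {a b} g g' h := match a, b, g, g', h with
    | .inl _, .inl _, _, _, h => congrArg (Sum.inl_ I (P.Obj P.trees)).map
        ((PTree.trivialArrow_faithful P).map_injective h)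
    | .inr _, .inr _, _, _, h => congrArg (Sum.inr_ I (P.Obj P.trees)).map
        ((graftArrow_faithful hP).map_injective h)

/-- The number of nodes, as a rank function on trees. -/
noncomputable def treeRank (hP : P.Finitary) : (treeAlg P hP).Rank where
  rank T := Nat.card T.N
  rank_eq h := Nat.card_congr (PTree.Hom.n h)
  rank_lt z k := by
    let ε := hP.enum z.b
    have h₁ : Nat.card (z.f.obj k).N = Nat.card (z.f.obj (ε.x (ε.lab k))).N :=
      Nat.card_congr (PTree.Hom.n (z.f.map (ε.iso k)))
    have := fun j => (z.f.obj (ε.x j)).finN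
    rw [h₁]
    -- The new node `none` adds one to the total number of nodes of the grafted trees, which makes
    -- the inequality strict.
    change _ < Nat.card (Option (Σ j, (z.f.obj (ε.x j)).N))
    rw [Finite.card_option]
    exact Nat.lt_succ_of_le (Nat.card_le_card_of_injective
      (Sigma.mk (β := fun j => (z.f.obj (ε.x j)).N) (ε.lab k)) sigma_mk_injective)

/-- The homotopy pullback condition gives each representative of the fibre over the root node an
isomorphic input `m j`. The family sends an object of the fibre to the branch at the input of its
class. -/
theorem exists_obj_hom (hP : P.Finitary) (T : PTree P) {n : T.N} (hn : T.t n = T.root) :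
    ∃ w : P.Obj P.trees, Nonempty ((graftArrow hP).F.obj w ⟶ T) := by
  obtain ⟨κ, hκ⟩ := T.exists_coloring hn
  let ε := hP.enum (T.ν n)
  choose m hm g hg using fun j => T.cart_surj n (ε.x j).e (ε.x j).φ
  let γ : ∀ j, T.inputFib (m j) (hm j) ⟶ ε.x j := fun j => ⟨g j, hg j⟩
  let r : ∀ k, k ⟶ T.inputFib (m (ε.lab k)) (hm (ε.lab k)) := fun k =>
    ε.iso k ≫ inv (γ (ε.lab k))
  have key : ∀ {k k' : P.Fib (T.ν n)} {j j' : ε.J} (f : k ⟶ k')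
      (r : k ⟶ T.inputFib (m j) (hm j)) (r' : k' ⟶ T.inputFib (m j') (hm j')) (h : j = j'),
      P.s.map f.g ≫ P.s.map r'.g ≫ T.cs (m j') = (P.s.map r.g ≫ T.cs (m j)) ≫
        (PTree.Hom.onRoot (eqToHom (congrArg (fun j => T.branch hP hκ (m j) (hm j)) h)) :
          T.α (T.s (m j)) ⟶ T.α (T.s (m j'))) := by
    rintro k k' j _ f r r' rfl
    rw [eqToHom_refl, PTree.onRoot_id, Category.comp_id, ← P.s.map_comp_assoc, ← fib_comp_g,
      hP.thin (f ≫ r') r]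
  let w : P.Obj P.trees :=
    { b := T.ν n
      f :=
        { obj := fun k => T.branch hP hκ (m (ε.lab k)) (hm (ε.lab k))
          -- Isomorphic objects of the fibre have the same label, hence equal branches, so arrows
          -- act by identifications. All variation is carried by the triangle `tri`, where `r`
          -- depends on the object.
          map := fun f => eqToHom (congrArg (fun j => T.branch hP hκ (m j) (hm j)) (ε.lab_eq f))
          map_id := fun _ => eqToHom_refl _ _
          map_comp := fun _ _ => (eqToHom_trans _ _).symm }
      tri := fun k => P.s.map (r k).g ≫ T.cs (m (ε.lab k))
      natural := fun f => key f _ _ (ε.lab_eq f) }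
  -- The label of the representative `ε.x j` is `j` only propositionally, so the inputs are indexed
  -- in the form that grafting `w` produces.
  refine ⟨w, T.exists_graft_hom hP hκ ε (fun j => m (ε.lab (ε.x j))) (fun j => hm _)
    (fun i j h => ?_) (fun i hi => ?_) fun j => r (ε.x j)⟩
  · simp only [ε.lab_x] at h
    have h' : ∀ {a b} (ha : T.p a = n) (hb : T.p b = n), a = b →
        Nonempty (T.inputFib a ha ⟶ T.inputFib b hb) := by
      rintro a _ ha hb rfl
      exact ⟨𝟙 _⟩
    rw [← ε.lab_x i, ← ε.lab_x j]
    -- Representatives assigned the same input are isomorphic through it, hence have the same label.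
    exact ε.lab_eq (inv (γ i) ≫ (h' (hm i) (hm j) h).some ≫ γ j)
  · let k := T.inputFib i hi
    refine ⟨ε.lab k, ?_⟩
    rw [ε.lab_x]
    refine (T.cart_inj i (m (ε.lab k)) (hi.trans (hm _).symm) (r k).g ?_).symm
    rw [← cancel_mono (eqToHom (congrArg T.ν (hm (ε.lab k)))), Category.assoc]
    exact (r k).w.trans (by simp [k])

theorem treeAlg_essSurj (hP : P.Finitary) (T : PTree P) :
    ∃ z, Nonempty ((treeAlg P hP).str.F.obj z ⟶ T) := by
  by_cases h : ∃ n, T.t n = T.root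
  · obtain ⟨n, hn⟩ := h
    obtain ⟨w, hw⟩ := exists_obj_hom hP T hn
    exact ⟨.inr w, hw⟩
  · exact ⟨.inl (T.α T.root), T.exists_trivial_hom fun n hn => h ⟨n, hn⟩⟩

end GrpdPoly

theorem mainTheorem1 {I : Type u} [Groupoid.{v} I] (P : GrpdPoly I) (hP : P.Finitary) :
    GrpdPoly.Alg.IsHomotopyInitial.{v, u, v, max 1 u v, y, x} (GrpdPoly.treeAlg P hP) ∧
      (GrpdPoly.treeAlg P hP).str.IsEquiv := by
  refine ⟨(GrpdPoly.treeRank hP).isHomotopyInitial (GrpdPoly.treeAlg_essSurj hP), ?_⟩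
  obtain ⟨l, ⟨a⟩, ⟨b⟩⟩ := GrpdOver.isEquiv_of_fullyFaithful_essSurj (GrpdPoly.treeAlg P hP).str
    (GrpdPoly.treeAlg_essSurj hP)
  exact ⟨l, ⟨asIso a⟩, ⟨asIso b⟩⟩
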